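/- **Proposition 5.11 (linear_quotients).** Let $(R,\mathfrak m,k)$ be either a noetherian local ring, or a standard graded algebra over a field $k$ with graded maximal ideal $\mathfrak m$ (that is, $R=\bigoplus_{n\ge 0}R_n$ is commutative, $R_0=k$, and $R$ is generated as a $k$-algebra by the finite-dimensional space $R_1$). In the second case all modules below are $\mathbb Z$-graded, and resolutions are graded. *Conventions.* Let $N$ be a finitely generated $R$-module with minimal free resolution $F$, so $\partial(F_i)\subseteq \mathfrak m F_{i-1}$. The linear part $\operatorname{lin}^R F$ is the associated graded complex of the filtration $(\mathcal G^nF)_i=\mathfrak m^{n-i}F_i$ (with $\mathfrak m^j=R$ for $j\le 0$), the linearity defect is $\operatorname{ld}_R N=\sup\{i: H_i(\operatorname{lin}^R F)\ne 0\}$ (and $0$ for $N=0$), and $N$ is a *Koszul module* if $\operatorname{ld}_R N=0$. The Betti number $\beta_s(N)$ is the rank of $F_s$, and $\operatorname{pd}_R N$ is the projective dimension. In the graded case, $\beta_{s,j}(N)=\dim_k \operatorname{Tor}^R_s(k,N)_j$ and $\operatorname{reg}_R N=\sup\{j-i:\operatorname{Tor}^R_i(k,N)_j\neq 0\}$. *Statement.*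 Let $M\ne 0$ be a finitely generated (graded) $R$-module with a minimal system of (homogeneous) generators $m_1,\dots,m_t$, put $I_i=(m_1,\dots,m_{i-1}):_R m_i$ for $1\le i\le t$, and suppose that every cyclic module $R/I_i$ is Koszul over $R$ (that is, $M$ has linear quotients). Then each submodule $(m_1,\dots,m_i)$ of $M$, $1\le i\le t$, is a Koszul module; in particular $M$ is a Koszul module. Moreover, $$\beta_s(M)=\sum_{i=1}^t\beta_s(R/I_i)\ \text{ for all } s\ge 0,\qquad \operatorname{pd}_R M=\max_{1\le i\le t}\operatorname{pd}_R(R/I_i).$$ In the graded case, if $\deg m_i=d_i\in\mathbb Z$, then also $$\beta_{s,j}(M)=\sum_{i=1}^t\beta_{s,j-d_i}(R/I_i)\ \text{ for all } s\ge 0,\ j\in\mathbb Z,\qquad \operatorname{reg}_R M=\max_{1\le i\le t}\{\operatorname{reg}_R(R/I_i)+d_i\}.$$ -/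

import Mathlib

universe u v

noncomputable section

namespace LinQuot

/-! ### Free resolutions, minimality, linear part -/

/-- A resolution `⋯ → F₁ → F₀ → M → 0` of the `R`-module `M` by free modules of finite rank,
`F i = R ^ (rank i)`. -/
structure FreeResolution (R : Type u) [CommRing R] (M : Type u) [AddCommGroup M] [Module R M] where
  /-- the rank of `F i` -/
  rank : ℕ → ℕ
  /-- the differential `F (i + 1) → F i` -/
  d : ∀ i, (Fin (rank (i + 1)) → R) →ₗ[R] (Fin (rank i) → R)
  /-- the augmentation `F 0 → M` -/
  aug : (Fin (rank 0) → R) →ₗ[R] M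
  aug_surjective : Function.Surjective aug
  exact_zero : Function.Exact (d 0) aug
  exact_succ : ∀ i, Function.Exact (d (i + 1)) (d i)

namespace FreeResolution

variable {R : Type u} [CommRing R] {M : Type u} [AddCommGroup M] [Module R M]

/-- The free module in homological degree `i`. -/
abbrev X (F : FreeResolution R M) (i : ℕ) : Type u := Fin (F.rank i) → R

/-- The resolution is minimal with respect to `𝔪`: the differential maps `F (i + 1)` into
`𝔪 F i`. -/
def IsMinimal (𝔪 : Ideal R) (F : FreeResolution R M) : Prop :=
  ∀ i, LinearMap.range (F.d i) ≤ 𝔪 • (⊤ : Submodule R (F.X i))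

/-- The filtration `(𝒢ⁿF) i = 𝔪^(n-i) F i`, where `𝔪^j = R` for `j ≤ 0` (so that the truncated
subtraction is the right one). The pieces with `n < 0` are all of `F` and contribute nothing to
the associated graded complex. -/
def filt (𝔪 : Ideal R) (F : FreeResolution R M) (n i : ℕ) : Submodule R (F.X i) :=
  𝔪 ^ (n - i) • ⊤

lemma filt_le_comap {𝔪 : Ideal R} {F : FreeResolution R M} (hF : F.IsMinimal 𝔪) (n i : ℕ) :
    F.filt 𝔪 n (i + 1) ≤ (F.filt 𝔪 n i).comap (F.d i) := by
  rw [← Submodule.map_le_iff_le_comap, filt, filt, Submodule.map_smul'', Submodule.map_top]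
  rcases Nat.lt_or_ge i n with h | h
  · obtain ⟨p, rfl⟩ : ∃ p, n = i + 1 + p := Nat.exists_eq_add_of_le h
    have h1 : i + 1 + p - (i + 1) = p := by omega
    have h2 : i + 1 + p - i = p + 1 := by omega
    rw [h1, h2, pow_succ, Submodule.mul_smul]
    exact Submodule.smul_mono le_rfl (hF i)
  · have h2 : n - i = 0 := by omega
    rw [h2, pow_zero, Ideal.one_eq_top, Submodule.top_smul]
    exact le_top

/-- The component `𝒢ⁿ(F i) / 𝒢ⁿ⁺¹(F i)` of the associated graded complex. -/
abbrev lin (𝔪 : Ideal R) (F : FreeResolution R M) (n i : ℕ) : Type u :=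
  (F.filt 𝔪 n i) ⧸ ((F.filt 𝔪 (n + 1) i).submoduleOf (F.filt 𝔪 n i))

/-- The differential of the linear part, induced by that of `F`. -/
def linD {𝔪 : Ideal R} {F : FreeResolution R M} (hF : F.IsMinimal 𝔪) (n i : ℕ) :
    F.lin 𝔪 n (i + 1) →ₗ[R] F.lin 𝔪 n i :=
  Submodule.mapQ _ _ ((F.d i).restrict (filt_le_comap hF n i))
    (fun _ hx => filt_le_comap hF (n + 1) i hx)

/-- The cycles of the linear part in homological degree `i`. -/
def linZ {𝔪 : Ideal R} {F : FreeResolution R M} (hF : F.IsMinimal 𝔪) (n : ℕ) :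
    (i : ℕ) → Submodule R (F.lin 𝔪 n i)
  | 0 => ⊤
  | i + 1 => LinearMap.ker (linD hF n i)

/-- The homology `H i` of the linear part, in degree `n`; the whole `H i` is the direct sum of
these over `n`. -/
abbrev linH {𝔪 : Ideal R} {F : FreeResolution R M} (hF : F.IsMinimal 𝔪) (n i : ℕ) : Type u :=
  (linZ hF n i) ⧸ ((LinearMap.range (linD hF n i)).submoduleOf (linZ hF n i))

/-- `sup {i : H i (lin F) ≠ 0}`; it is `0` if all the homology vanishes. -/
def linDefect {𝔪 : Ideal R} {F : FreeResolution R M} (hF : F.IsMinimal 𝔪) : ℕ∞ :=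
  ⨆ (i : ℕ) (_ : ∃ n, Nontrivial (linH hF n i)), (i : ℕ∞)

end FreeResolution

/-! ### Invariants over a local ring

A minimal free resolution of a finitely generated module over a noetherian local ring exists and is
unique up to isomorphism, so each infimum below is the value on any one of them. -/

section Local

variable (R : Type u) [CommRing R] [IsLocalRing R] (M : Type u) [AddCommGroup M] [Module R M]

/-- The minimal free resolutions of `M`. -/
abbrev MinRes : Type u :=
  {F : FreeResolution R M // F.IsMinimal (IsLocalRing.maximalIdeal R)}

/-- The linearity defect `ld_R M`. -/
def linearityDefect : ℕ∞ :=
  ⨅ F : MinRes R M, FreeResolution.linDefect F.2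

/-- `M` is a Koszul module. -/
def IsKoszul : Prop := linearityDefect R M = 0

/-- The Betti number `β_s(M)`: the rank of the `s`-th module in a minimal free resolution. -/
def betti (s : ℕ) : ℕ := ⨅ F : MinRes R M, F.1.rank s

end Local

/-! ### Standard graded algebras and graded resolutions -/

/-- `R = ⨁ R_n` is a standard graded `k`-algebra: `R_n = 0` for `n < 0`, `R_0 = k`, and `R` is
generated over `k` by the finite-dimensional space `R_1`. -/
structure IsStandardGraded {k : Type v} [Field k] {R : Type u} [CommRing R] [Algebra k R]
    (𝒜 : ℤ → Submodule k R) : Prop where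
  nontrivial : Nontrivial R
  neg : ∀ n < 0, 𝒜 n = ⊥
  zero : ∀ x ∈ 𝒜 0, ∃ c : k, algebraMap k R c = x
  finite : FiniteDimensional k (𝒜 1)
  adjoin : Algebra.adjoin k (𝒜 1 : Set R) = ⊤

section Graded

variable {k : Type v} [Field k] {R : Type u} [CommRing R] [Algebra k R]

/-- The graded maximal ideal, generated by the homogeneous elements of positive degree. -/
def gradedMaximalIdeal (𝒜 : ℤ → Submodule k R) : Ideal R :=
  Ideal.span {x | ∃ n : ℤ, 0 < n ∧ x ∈ 𝒜 n}

/-- The grading of `R ⧸ I` induced by that of `R`. -/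
def quotGrading (𝒜 : ℤ → Submodule k R) (I : Ideal R) (n : ℤ) : AddSubgroup (R ⧸ I) :=
  (𝒜 n).toAddSubgroup.map (Submodule.mkQ I).toAddMonoidHom

/-- The grading of a submodule `N` induced by that of the ambient module. -/
def subGrading {M : Type u} [AddCommGroup M] [Module R M] (ℳ : ℤ → AddSubgroup M)
    (N : Submodule R M) (n : ℤ) : AddSubgroup N :=
  (ℳ n).comap N.subtype.toAddMonoidHom

/-- A graded free resolution of the graded module `M = ⨁ ℳ n` over `R = ⨁ 𝒜 n`: the basis vector
`e_a` of `F i` has degree `deg i a`, i.e. `F i = ⨁_a R(-deg i a)`, and all the maps preserve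
degrees. -/
structure GradedFreeResolution (𝒜 : ℤ → Submodule k R) {M : Type u} [AddCommGroup M] [Module R M]
    (ℳ : ℤ → AddSubgroup M) extends FreeResolution R M where
  deg : ∀ i, Fin (rank i) → ℤ
  d_mem : ∀ i a b, d i (Pi.single a 1) b ∈ 𝒜 (deg (i + 1) a - deg i b)
  aug_mem : ∀ a, aug (Pi.single a 1) ∈ ℳ (deg 0 a)

namespace GradedFreeResolution

variable {𝒜 : ℤ → Submodule k R} {M : Type u} [AddCommGroup M] [Module R M] {ℳ : ℤ → AddSubgroup M}

/-- The degree `j` component of `F i = ⨁_a R(-deg i a)`. -/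
def piece (F : GradedFreeResolution 𝒜 ℳ) (i : ℕ) (j : ℤ) : Submodule k (F.X i) where
  carrier := {x | ∀ a, x a ∈ 𝒜 (j - F.deg i a)}
  add_mem' hx hy a := add_mem (hx a) (hy a)
  zero_mem' _ := zero_mem _
  smul_mem' c _ hx a := Submodule.smul_mem _ c (hx a)

/-- The elements of `𝔪 F i`, as a `k`-subspace. -/
def maxPart (F : GradedFreeResolution 𝒜 ℳ) (i : ℕ) : Submodule k (F.X i) :=
  (gradedMaximalIdeal 𝒜 • (⊤ : Submodule R (F.X i))).restrictScalars k

lemma piece_le_comap [GradedAlgebra 𝒜] (F : GradedFreeResolution 𝒜 ℳ) (i : ℕ) (j : ℤ) :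
    F.piece (i + 1) j ≤ (F.piece i j).comap ((F.d i).restrictScalars k) := by
  intro x hx b
  have h : F.d i x = ∑ a, x a • F.d i (Pi.single a 1) := by
    conv_lhs => rw [pi_eq_sum_univ' x]
    rw [map_sum]
    exact Finset.sum_congr rfl fun a _ => by rw [map_smul]
  change F.d i x b ∈ _
  rw [h, Finset.sum_apply]
  refine sum_mem fun a _ => ?_
  have := SetLike.GradedMul.mul_mem (hx a) (F.d_mem i a b)
  rwa [sub_add_sub_cancel] at this

lemma maxPart_le_comap (F : GradedFreeResolution 𝒜 ℳ) (i : ℕ) :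
    F.maxPart (i + 1) ≤ (F.maxPart i).comap ((F.d i).restrictScalars k) := by
  intro x hx
  change F.d i x ∈ gradedMaximalIdeal 𝒜 • (⊤ : Submodule R (F.X i))
  have h : F.d i x ∈ (gradedMaximalIdeal 𝒜 • (⊤ : Submodule R (F.X (i + 1)))).map (F.d i) :=
    Submodule.mem_map_of_mem hx
  rw [Submodule.map_smul''] at h
  exact Submodule.smul_mono le_rfl le_top h

/-- The degree `j` component of `k ⊗ F i = F i / 𝔪 F i`. -/
abbrev red (F : GradedFreeResolution 𝒜 ℳ) (i : ℕ) (j : ℤ) : Type u :=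
  (F.piece i j) ⧸ ((F.maxPart i).submoduleOf (F.piece i j))

/-- The degree `j` component of the differential of `k ⊗ F`. -/
def redD [GradedAlgebra 𝒜] (F : GradedFreeResolution 𝒜 ℳ) (i : ℕ) (j : ℤ) :
    F.red (i + 1) j →ₗ[k] F.red i j :=
  Submodule.mapQ _ _ (((F.d i).restrictScalars k).restrict (F.piece_le_comap i j))
    (fun _ hx => F.maxPart_le_comap i hx)

/-- The degree `j` cycles of `k ⊗ F` in homological degree `i`. -/
def redZ [GradedAlgebra 𝒜] (F : GradedFreeResolution 𝒜 ℳ) (j : ℤ) :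
    (i : ℕ) → Submodule k (F.red i j)
  | 0 => ⊤
  | i + 1 => LinearMap.ker (F.redD i j)

/-- `Tor_i(k, M)_j`, computed as the degree `j` component of `H_i(k ⊗ F)`. -/
abbrev tor [GradedAlgebra 𝒜] (F : GradedFreeResolution 𝒜 ℳ) (i : ℕ) (j : ℤ) : Type u :=
  (F.redZ j i) ⧸ ((LinearMap.range (F.redD i j)).submoduleOf (F.redZ j i))

end GradedFreeResolution

/-! ### Invariants of graded modules

As in the local case, for finitely generated graded modules over a standard graded algebra each
infimum is the value on any one of the resolutions over which it is taken. -/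

variable (𝒜 : ℤ → Submodule k R) {M : Type u} [AddCommGroup M] [Module R M] (ℳ : ℤ → AddSubgroup M)

/-- The minimal graded free resolutions of `M`. -/
abbrev GradedMinRes : Type u :=
  {F : GradedFreeResolution 𝒜 ℳ // F.toFreeResolution.IsMinimal (gradedMaximalIdeal 𝒜)}

/-- The linearity defect of a graded module. -/
def gradedLinearityDefect : ℕ∞ :=
  ⨅ F : GradedMinRes 𝒜 ℳ, FreeResolution.linDefect F.2

/-- The graded module `M` is Koszul. -/
def IsGradedKoszul : Prop := gradedLinearityDefect 𝒜 ℳ = 0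

/-- The total Betti number `β_s(M)` of a graded module: the rank of the `s`-th module in a minimal
graded free resolution. -/
def totalBetti (s : ℕ) : ℕ := ⨅ F : GradedMinRes 𝒜 ℳ, F.1.rank s

/-- The graded Betti number `β_{s,j}(M) = dim_k Tor_s(k, M)_j`. -/
def gradedBetti [GradedAlgebra 𝒜] (s : ℕ) (j : ℤ) : ℕ :=
  ⨅ F : GradedFreeResolution 𝒜 ℳ, Module.finrank k (F.tor s j)

/-- The Castelnuovo–Mumford regularity `sup {j - i : Tor_i(k, M)_j ≠ 0}`. -/
def regularity [GradedAlgebra 𝒜] : EReal :=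
  ⨆ (i : ℕ) (j : ℤ) (_ : gradedBetti 𝒜 ℳ i j ≠ 0), (((j - i : ℤ) : ℝ) : EReal)

end Graded

/-! ### Generators and quotients -/

section Generators

variable {R : Type u} [CommRing R] {M : Type u} [AddCommGroup M] [Module R M] {t : ℕ}

/-- `m` is a minimal system of generators of `M`: it generates `M`, and none of its members can be
omitted. -/
def IsMinimalGenerators (m : Fin t → M) : Prop :=
  Submodule.span R (Set.range m) = ⊤ ∧ ∀ i, Submodule.span R (m '' {i}ᶜ) ≠ ⊤

/-- The submodule generated by the first `i` members of `m`. -/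
def initial (R : Type u) [CommRing R] {M : Type u} [AddCommGroup M] [Module R M] {t : ℕ}
    (m : Fin t → M) (i : ℕ) : Submodule R M :=
  Submodule.span R (m '' {j | (j : ℕ) < i})

/-- The ideal `(m_1, …, m_{i-1}) : m_i` (with members of `m` indexed from `0`, the submodule is
generated by the members that precede `m i`). -/
def colonIdeal (R : Type u) [CommRing R] {M : Type u} [AddCommGroup M] [Module R M] {t : ℕ}
    (m : Fin t → M) (i : Fin t) : Ideal R :=
  (initial R m i).colon {m i}

end Generators

/-- The projective dimension of a module, in `{-∞} ∪ ℕ ∪ {∞}`. -/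
def projDim (R : Type u) [CommRing R] (M : Type u) [AddCommGroup M] [Module R M] : WithBot ℕ∞ :=
  CategoryTheory.projectiveDimension (ModuleCat.of R M)

end LinQuot

end

/-!
Put `N_i = (m_1, …, m_i)`, so that `0 → N_{i-1} → N_i → R/I_i → 0` is exact. Minimality of the
generators gives `𝔪 N_i ∩ N_{i-1} = 𝔪 N_{i-1}`, so the connecting map of this sequence sends the
first syzygy of `R/I_i` into `𝔪 N_{i-1}`. If `F'` is a minimal resolution of `N_{i-1}` with acyclic
linear part, then an element of `𝔪² F'` in the image of the differential is the image of an element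
of `𝔪 F'`; hence the connecting map lifts to a chain map with values in `𝔪 F'`. Its mapping cone is
therefore a minimal resolution of `N_i`, and its linear part is again acyclic. The invariants of
`M = N_t` are read off the iterated cone.
-/

noncomputable section

namespace LinQuot

section FreeModules

variable {R : Type*} [CommRing R] {κ N P : Type*}
  [AddCommGroup N] [Module R N] [AddCommGroup P] [Module R P]

lemma mem_smul_top_pi_iff [Finite κ] (I : Ideal R) {x : κ → R} :
    x ∈ I • (⊤ : Submodule R (κ → R)) ↔ ∀ a, x a ∈ I := by
  classical
  have := Fintype.ofFinite κ
  refine ⟨fun hx a => ?_, fun hx => ?_⟩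
  · simpa using Submodule.smul_top_le_comap_smul_top I (LinearMap.proj a) hx
  · rw [pi_eq_sum_univ' x]
    exact sum_mem fun a _ => Submodule.smul_mem_smul (hx a) trivial

lemma mem_pow_zero_smul_top (I : Ideal R) (x : N) : x ∈ I ^ 0 • (⊤ : Submodule R N) := by
  simp

lemma map_mem_pow_succ_smul_top {I : Ideal R} {f : N →ₗ[R] P}
    (hf : ∀ x, f x ∈ I • (⊤ : Submodule R P)) {q : ℕ} {x : N}
    (hx : x ∈ I ^ q • (⊤ : Submodule R N)) : f x ∈ I ^ (q + 1) • (⊤ : Submodule R P) := by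
  have hfx : f x ∈ (I ^ q • (⊤ : Submodule R N)).map f := Submodule.mem_map_of_mem hx
  rw [Submodule.map_smul''] at hfx
  rw [pow_succ, Submodule.mul_smul]
  exact smul_mono_right _ (Submodule.map_le_iff_le_comap.2 fun y _ => hf y) hfx

lemma linearMap_pi_apply [Fintype κ] [DecidableEq κ] (f : (κ → R) →ₗ[R] N) (x : κ → R) :
    f x = ∑ a, x a • f (Pi.single a 1) := by
  conv_lhs => rw [pi_eq_sum_univ' x]
  simp only [map_sum, map_smul]

lemma linearMap_pi_apply_mem [Finite κ] [DecidableEq κ] {f : (κ → R) →ₗ[R] N} {L : Submodule R N}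
    (h : ∀ a, f (Pi.single a 1) ∈ L) (x : κ → R) : f x ∈ L := by
  have := Fintype.ofFinite κ
  rw [linearMap_pi_apply]
  exact sum_mem fun a _ => L.smul_mem _ (h a)

lemma exists_linearMap_pi_comp_eq [Finite κ] [DecidableEq κ] {p : P →ₗ[R] N}
    {f : (κ → R) →ₗ[R] N} (Q : κ → Set P) (h : ∀ a, ∃ y ∈ Q a, p y = f (Pi.single a 1)) :
    ∃ φ : (κ → R) →ₗ[R] P, (∀ a, φ (Pi.single a 1) ∈ Q a) ∧ ∀ x, p (φ x) = f x := by
  have := Fintype.ofFinite κ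
  choose y hyQ hy using h
  refine ⟨Fintype.linearCombination R y, fun a => by simpa using hyQ a, fun x => ?_⟩
  have : p ∘ₗ Fintype.linearCombination R y = f :=
    (Pi.basisFun R κ).ext fun a => by simpa using hy a
  exact LinearMap.congr_fun this x

lemma card_le_card_of_comp_sub_self_mem {ν : Type*} [Fintype κ] [Fintype ν] {I : Ideal R}
    (hI : I ≠ ⊤) (f : (κ → R) →ₗ[R] ν → R) (g : (ν → R) →ₗ[R] κ → R)
    (h : ∀ x, g (f x) - x ∈ I • (⊤ : Submodule R (κ → R))) :
    Fintype.card κ ≤ Fintype.card ν := by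
  classical
  have : Nontrivial (R ⧸ I) := Ideal.Quotient.nontrivial_iff.2 hI
  let A := (LinearMap.toMatrix' f).map (Ideal.Quotient.mk I)
  let B := (LinearMap.toMatrix' g).map (Ideal.Quotient.mk I)
  have hBA : B * A = 1 := by
    rw [← Matrix.map_mul, ← LinearMap.toMatrix'_comp]
    ext a b
    have hab := (mem_smul_top_pi_iff I).1 (h (Pi.single b 1)) a
    rw [Pi.sub_apply, ← Ideal.Quotient.eq] at hab
    rw [Matrix.map_apply, LinearMap.toMatrix'_apply, LinearMap.comp_apply, hab, Matrix.one_apply,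
      Pi.single_apply]
    split_ifs <;> simp
  refine card_le_of_injective (R ⧸ I) A.mulVecLin
    (Function.LeftInverse.injective (g := B.mulVecLin) fun x => ?_)
  simp [Matrix.mulVec_mulVec, hBA]

end FreeModules

lemma exists_seq_of_step {A : ℕ → Type*} (P : ∀ n, A n → Prop) (r : ∀ n, A n → A (n + 1) → Prop)
    (a₀ : A 0) (h₀ : P 0 a₀) (hs : ∀ n a, P n a → ∃ b, P (n + 1) b ∧ r n a b) :
    ∃ f : ∀ n, A n, f 0 = a₀ ∧ (∀ n, P n (f n)) ∧ ∀ n, r n (f n) (f (n + 1)) := by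
  choose g hgP hgr using hs
  let f : ∀ n, {a : A n // P n a} := fun n =>
    Nat.rec ⟨a₀, h₀⟩ (fun n a => ⟨g n a.1 a.2, hgP n a.1 a.2⟩) n
  exact ⟨fun n => (f n).1, rfl, fun n => (f n).2, fun n => hgr n _ (f n).2⟩

namespace FreeResolution

variable {R : Type u} [CommRing R] {𝔪 : Ideal R} {M N L : Type u} [AddCommGroup M] [Module R M]
  [AddCommGroup N] [Module R N] [AddCommGroup L] [Module R L]

lemma d_d (F : FreeResolution R M) (i : ℕ) (x : F.X (i + 2)) : F.d i (F.d (i + 1) x) = 0 :=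
  (F.exact_succ i).apply_apply_eq_zero x

lemma aug_d (F : FreeResolution R M) (x : F.X 1) : F.aug (F.d 0 x) = 0 :=
  F.exact_zero.apply_apply_eq_zero x

lemma IsMinimal.d_mem {F : FreeResolution R M} (hF : F.IsMinimal 𝔪) (i : ℕ) (x : F.X (i + 1)) :
    F.d i x ∈ 𝔪 • (⊤ : Submodule R (F.X i)) :=
  hF i ⟨x, rfl⟩

/-- The family `α` is a chain map from `F` to `G` that lifts the module homomorphism `f`. -/
structure IsLift (f : M →ₗ[R] N) (F : FreeResolution R M) (G : FreeResolution R N)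
    (α : ∀ i, F.X i →ₗ[R] G.X i) : Prop where
  aug_apply : ∀ x, G.aug (α 0 x) = f (F.aug x)
  d_apply : ∀ i x, G.d i (α (i + 1) x) = α i (F.d i x)

lemma IsLift.refl (F : FreeResolution R M) : IsLift LinearMap.id F F fun _ => LinearMap.id :=
  ⟨fun _ => rfl, fun _ _ => rfl⟩

lemma IsLift.comp {f : M →ₗ[R] N} {g : N →ₗ[R] L} {F : FreeResolution R M}
    {G : FreeResolution R N} {H : FreeResolution R L} {α : ∀ i, F.X i →ₗ[R] G.X i}
    {β : ∀ i, G.X i →ₗ[R] H.X i} (hβ : IsLift g G H β) (hα : IsLift f F G α) :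
    IsLift (g ∘ₗ f) F H fun i => β i ∘ₗ α i :=
  ⟨fun x => by simp [hβ.aug_apply, hα.aug_apply], fun i x => by simp [hβ.d_apply, hα.d_apply]⟩

lemma IsLift.sub {f g : M →ₗ[R] N} {F : FreeResolution R M} {G : FreeResolution R N}
    {α β : ∀ i, F.X i →ₗ[R] G.X i} (hα : IsLift f F G α) (hβ : IsLift g F G β) :
    IsLift (f - g) F G fun i => α i - β i :=
  ⟨fun x => by simp [hα.aug_apply, hβ.aug_apply], fun i x => by simp [hα.d_apply, hβ.d_apply]⟩

lemma exists_isLift_mem (f : M →ₗ[R] N) (F : FreeResolution R M) (G : FreeResolution R N)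
    (Q : ∀ i, Fin (F.rank i) → Set (G.X i))
    (hQ₀ : ∀ a, ∃ y ∈ Q 0 a, G.aug y = f (F.aug (Pi.single a 1)))
    (hQ : ∀ i (φ : F.X i →ₗ[R] G.X i), (∀ b, φ (Pi.single b 1) ∈ Q i b) →
      ∀ a, φ (F.d i (Pi.single a 1)) ∈ LinearMap.range (G.d i) →
        ∃ y ∈ Q (i + 1) a, G.d i y = φ (F.d i (Pi.single a 1))) :
    ∃ α, IsLift f F G α ∧ ∀ i a, α i (Pi.single a 1) ∈ Q i a := by
  obtain ⟨α₀, hα₀Q, hα₀⟩ := exists_linearMap_pi_comp_eq (f := f ∘ₗ F.aug) (Q 0) hQ₀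
  obtain ⟨α, rfl, hα, hd⟩ := exists_seq_of_step (A := fun i => F.X i →ₗ[R] G.X i)
    (fun i φ => (∀ a, φ (Pi.single a 1) ∈ Q i a) ∧
      ∀ x, φ (F.d i x) ∈ LinearMap.range (G.d i))
    (fun i φ ψ => ∀ x, G.d i (ψ x) = φ (F.d i x)) α₀
    ⟨hα₀Q, fun x => (G.exact_zero _).1 (by simp [hα₀, aug_d])⟩
    (fun i φ ⟨hφQ, hφ⟩ => by
      obtain ⟨ψ, hψQ, hψ⟩ := exists_linearMap_pi_comp_eq (f := φ ∘ₗ F.d i) (Q (i + 1))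
        fun a => hQ i φ hφQ a (hφ _)
      exact ⟨ψ, ⟨hψQ, fun x => (G.exact_succ i _).1 (by simp [hψ, d_d])⟩, hψ⟩)
  exact ⟨α, ⟨hα₀, hd⟩, fun i => (hα i).1⟩

lemma exists_isLift (f : M →ₗ[R] N) (F : FreeResolution R M) (G : FreeResolution R N) :
    ∃ α, IsLift f F G α := by
  obtain ⟨α, hα, -⟩ := exists_isLift_mem f F G (fun _ _ => Set.univ)
    (fun a => by simpa using G.aug_surjective _) (fun i φ _ a h => by simpa using h)
  exact ⟨α, hα⟩

lemma IsLift.exists_homotopy {F : FreeResolution R M} {G : FreeResolution R N}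
    {γ : ∀ i, F.X i →ₗ[R] G.X i} (hγ : IsLift 0 F G γ) :
    ∃ h : ∀ i, F.X i →ₗ[R] G.X (i + 1), (∀ x, G.d 0 (h 0 x) = γ 0 x) ∧
      ∀ i x, G.d (i + 1) (h (i + 1) x) = γ (i + 1) x - h i (F.d i x) := by
  obtain ⟨h₀, -, hh₀⟩ := exists_linearMap_pi_comp_eq (p := G.d 0) (f := γ 0) (fun _ => Set.univ)
    fun a => by simpa using (G.exact_zero _).1 (hγ.aug_apply _)
  obtain ⟨h, rfl, -, hh⟩ := exists_seq_of_step (A := fun i => F.X i →ₗ[R] G.X (i + 1))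
    (fun i φ => ∀ x, γ (i + 1) x - φ (F.d i x) ∈ LinearMap.range (G.d (i + 1)))
    (fun i φ ψ => ∀ x, G.d (i + 1) (ψ x) = γ (i + 1) x - φ (F.d i x)) h₀
    (fun x => (G.exact_succ 0 _).1 (by simp [hγ.d_apply, hh₀]))
    (fun i φ hφ => by
      obtain ⟨ψ, -, hψ⟩ := exists_linearMap_pi_comp_eq (p := G.d (i + 1))
        (f := γ (i + 1) - φ ∘ₗ F.d i) (fun _ => Set.univ) fun a => by simpa using hφ _
      exact ⟨ψ, fun x => (G.exact_succ (i + 1) _).1 (by simp [hγ.d_apply, hψ, d_d]), hψ⟩)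
  exact ⟨h, hh₀, hh⟩

lemma IsLift.mem_smul_top_of_isMinimal {F : FreeResolution R M} {G : FreeResolution R N}
    {γ : ∀ i, F.X i →ₗ[R] G.X i} (hγ : IsLift 0 F G γ) (hF : F.IsMinimal 𝔪)
    (hG : G.IsMinimal 𝔪) (i : ℕ) (x : F.X i) : γ i x ∈ 𝔪 • (⊤ : Submodule R (G.X i)) := by
  obtain ⟨h, h₀, hs⟩ := hγ.exists_homotopy
  cases i with
  | zero => exact h₀ x ▸ hG.d_mem _ _
  | succ i =>
    rw [← sub_add_cancel (γ (i + 1) x) (h i (F.d i x)), ← hs]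
    exact add_mem (hG.d_mem _ _) (Submodule.smul_top_le_comap_smul_top 𝔪 (h i) (hF.d_mem i x))

lemma IsLift.sub_self_mem {F : FreeResolution R M} {γ : ∀ i, F.X i →ₗ[R] F.X i}
    (hγ : IsLift LinearMap.id F F γ) (hF : F.IsMinimal 𝔪) (i : ℕ) (x : F.X i) :
    γ i x - x ∈ 𝔪 • (⊤ : Submodule R (F.X i)) :=
  (sub_self (LinearMap.id : M →ₗ[R] M) ▸ hγ.sub (.refl F)).mem_smul_top_of_isMinimal hF hF i x

lemma IsMinimal.rank_le (h𝔪 : 𝔪 ≠ ⊤) {F : FreeResolution R M} (hF : F.IsMinimal 𝔪)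
    (G : FreeResolution R M) (i : ℕ) : F.rank i ≤ G.rank i := by
  obtain ⟨α, hα⟩ := exists_isLift LinearMap.id F G
  obtain ⟨β, hβ⟩ := exists_isLift LinearMap.id G F
  simpa using card_le_card_of_comp_sub_self_mem h𝔪 (α i) (β i) ((hβ.comp hα).sub_self_mem hF i)

lemma IsMinimal.rank_eq (h𝔪 : 𝔪 ≠ ⊤) {F G : FreeResolution R M} (hF : F.IsMinimal 𝔪)
    (hG : G.IsMinimal 𝔪) (i : ℕ) : F.rank i = G.rank i :=
  (hF.rank_le h𝔪 G i).antisymm (hG.rank_le h𝔪 F i)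

lemma IsLift.mem_smul_top_of_sub_d_mem {F G : FreeResolution R M}
    {α : ∀ i, F.X i →ₗ[R] G.X i} (hα : IsLift LinearMap.id F G α) (hF : F.IsMinimal 𝔪) {i : ℕ}
    {x : F.X i} {w : G.X (i + 1)} (hx : α i x - G.d i w ∈ 𝔪 • (⊤ : Submodule R (G.X i))) :
    x ∈ 𝔪 • (⊤ : Submodule R (F.X i)) := by
  obtain ⟨β, hβ⟩ := exists_isLift LinearMap.id G F
  have hβx : β i (α i x) - F.d i (β (i + 1) w) ∈ 𝔪 • (⊤ : Submodule R (F.X i)) := by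
    rw [hβ.d_apply, ← map_sub]
    exact Submodule.smul_top_le_comap_smul_top 𝔪 (β i) hx
  have hβα : β i (α i x) ∈ 𝔪 • (⊤ : Submodule R (F.X i)) :=
    (Submodule.sub_mem_iff_left _ (hF.d_mem i _)).1 hβx
  exact (Submodule.sub_mem_iff_right _ hβα).1 ((hβ.comp hα).sub_self_mem hF i x)

end FreeResolution

namespace FreeResolution

variable {R : Type u} [CommRing R] {𝔪 : Ideal R} {M : Type u} [AddCommGroup M] [Module R M]

/-- The differentials of `F` are strict for the filtrations that define the linear part. For a
minimal resolution this says that the linear part is acyclic in positive degrees, and it is easier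
to handle than the homology of the linear part. -/
def IsLinear (𝔪 : Ideal R) (F : FreeResolution R M) : Prop :=
  ∀ (i q : ℕ) (x : F.X (i + 1)), F.d i x ∈ 𝔪 ^ (q + 1) • (⊤ : Submodule R (F.X i)) →
    ∃ y ∈ 𝔪 ^ q • (⊤ : Submodule R (F.X (i + 1))), F.d i y = F.d i x

lemma filt_add (F : FreeResolution R M) (i p : ℕ) : F.filt 𝔪 (i + p) i = 𝔪 ^ p • ⊤ := by
  rw [filt, Nat.add_sub_cancel_left]

lemma filt_eq_top (F : FreeResolution R M) {n i : ℕ} (h : n ≤ i) : F.filt 𝔪 n i = ⊤ := by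
  rw [filt, Nat.sub_eq_zero_of_le h, pow_zero, Ideal.one_eq_top, Submodule.top_smul]

lemma linD_mk_eq_mk_iff {F : FreeResolution R M} (hF : F.IsMinimal 𝔪) {n i : ℕ}
    {x : F.X (i + 1)} (hx : x ∈ F.filt 𝔪 n (i + 1)) {y : F.X i} (hy : y ∈ F.filt 𝔪 n i) :
    linD hF n i (Submodule.Quotient.mk ⟨x, hx⟩) = Submodule.Quotient.mk ⟨y, hy⟩ ↔
      F.d i x - y ∈ F.filt 𝔪 (n + 1) i :=
  Submodule.Quotient.eq _

lemma subsingleton_linH_succ_iff {F : FreeResolution R M} (hF : F.IsMinimal 𝔪) (n i : ℕ) :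
    Subsingleton (linH hF n (i + 1)) ↔
      ∀ x ∈ F.filt 𝔪 n (i + 1), F.d i x ∈ F.filt 𝔪 (n + 1) i →
        ∃ y ∈ F.filt 𝔪 n (i + 2), F.d (i + 1) y - x ∈ F.filt 𝔪 (n + 1) (i + 1) := by
  have mk_mem_linZ (x) (hx : x ∈ F.filt 𝔪 n (i + 1)) :
      Submodule.Quotient.mk ⟨x, hx⟩ ∈ linZ hF n (i + 1) ↔ F.d i x ∈ F.filt 𝔪 (n + 1) i :=
    Submodule.Quotient.mk_eq_zero _
  rw [Submodule.Quotient.subsingleton_iff, Submodule.submoduleOf_eq_top]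
  refine ⟨fun h x hx hdx => ?_, fun h z hz => ?_⟩
  · obtain ⟨z, hz⟩ := h ((mk_mem_linZ x hx).2 hdx)
    obtain ⟨⟨y, hy⟩, rfl⟩ := Submodule.Quotient.mk_surjective _ z
    exact ⟨y, hy, (linD_mk_eq_mk_iff hF hy hx).1 hz⟩
  · obtain ⟨⟨x, hx⟩, rfl⟩ := Submodule.Quotient.mk_surjective _ z
    obtain ⟨y, hy, hyx⟩ := h x hx ((mk_mem_linZ x hx).1 hz)
    exact ⟨Submodule.Quotient.mk ⟨y, hy⟩, (linD_mk_eq_mk_iff hF hy hx).2 hyx⟩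

lemma linDefect_eq_zero_iff_subsingleton {F : FreeResolution R M} (hF : F.IsMinimal 𝔪) :
    linDefect hF = 0 ↔ ∀ n i, Subsingleton (linH hF n (i + 1)) := by
  simp only [linDefect, ENat.iSup_eq_zero, Nat.cast_eq_zero]
  refine ⟨fun h n i => ?_, fun h i ⟨n, hn⟩ => ?_⟩
  · by_contra hn
    exact Nat.succ_ne_zero i (h (i + 1) ⟨n, not_subsingleton_iff_nontrivial.1 hn⟩)
  · by_contra hi
    obtain ⟨i, rfl⟩ := Nat.exists_eq_succ_of_ne_zero hi
    exact not_subsingleton_iff_nontrivial.2 hn (h n i)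

lemma isLinear_of_subsingleton_linH {F : FreeResolution R M} (hF : F.IsMinimal 𝔪)
    (h : ∀ n i, Subsingleton (linH hF n (i + 1))) : F.IsLinear 𝔪 := by
  intro i q x
  induction q with
  | zero => exact fun _ => ⟨x, mem_pow_zero_smul_top 𝔪 x, rfl⟩
  | succ q ih =>
    intro hx
    obtain ⟨y, hy, hyx⟩ := ih (Submodule.smul_mono_left (Ideal.pow_le_pow_right (by lia)) hx)
    have hdy : F.d i y ∈ F.filt 𝔪 (i + (q + 2)) i := by rwa [filt_add, hyx]
    have hy' : y ∈ F.filt 𝔪 (i + 1 + q) (i + 1) := by rwa [filt_add]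
    obtain ⟨z, -, hz⟩ := (subsingleton_linH_succ_iff hF (i + 1 + q) i).1 (h _ i) y hy'
      (by convert hdy using 2; lia)
    rw [add_assoc, filt_add] at hz
    exact ⟨y - F.d (i + 1) z, by simpa using neg_mem hz, by simp [d_d, hyx]⟩

lemma IsLinear.subsingleton_linH {F : FreeResolution R M} (h : F.IsLinear 𝔪)
    (hF : F.IsMinimal 𝔪) (n i : ℕ) : Subsingleton (linH hF n (i + 1)) := by
  rw [subsingleton_linH_succ_iff]
  intro x hx hdx
  obtain hn | ⟨p, rfl⟩ := (Nat.lt_or_ge n (i + 1)).imp_right Nat.exists_eq_add_of_le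
  · exact ⟨0, zero_mem _, by simp [filt_eq_top F hn]⟩
  rw [filt_add] at hx
  rw [show i + 1 + p + 1 = i + (p + 1 + 1) by lia, filt_add] at hdx
  obtain ⟨y, hy, hyx⟩ := h i (p + 1) x hdx
  obtain ⟨z, hz⟩ := (F.exact_succ i (x - y)).1 (by rw [map_sub, hyx, sub_self])
  suffices ∃ w ∈ F.filt 𝔪 (i + 1 + p) (i + 2), F.d (i + 1) w = x - y by
    obtain ⟨w, hw, hwz⟩ := this
    exact ⟨w, hw, by rw [hwz, add_assoc, filt_add]; simpa using hy⟩
  cases p with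
  | zero => exact ⟨z, by simp [filt_eq_top], hz⟩
  | succ p =>
    have hxy : x - y ∈ 𝔪 ^ (p + 1) • (⊤ : Submodule R (F.X (i + 1))) :=
      sub_mem hx (Submodule.smul_mono_left (Ideal.pow_le_pow_right (by lia)) hy)
    obtain ⟨w, hw, hwz⟩ := h (i + 1) p z (hz ▸ hxy)
    exact ⟨w, by rwa [show i + 1 + (p + 1) = i + 2 + p by lia, filt_add], hwz.trans hz⟩

lemma linDefect_eq_zero_iff {F : FreeResolution R M} (hF : F.IsMinimal 𝔪) :
    linDefect hF = 0 ↔ F.IsLinear 𝔪 :=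
  (linDefect_eq_zero_iff_subsingleton hF).trans
    ⟨isLinear_of_subsingleton_linH hF, fun h => h.subsingleton_linH hF⟩

end FreeResolution

lemma withBot_enat_le_of_forall_natCast_le {a b : WithBot ℕ∞} (h : ∀ n : ℕ, n ≤ a → n ≤ b) :
    a ≤ b := by
  induction a with
  | bot => exact bot_le
  | coe a =>
    induction a with
    | top => exact (ENat.WithBot.eq_top_iff_forall_ge.2 fun n => h n le_top).ge
    | coe n => exact h n le_rfl

namespace FreeResolution
open CategoryTheory

variable {R : Type u} [CommRing R] {𝔪 : Ideal R} {M : Type u} [AddCommGroup M] [Module R M]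

/-- The resolution of the first syzygy module obtained by truncating `F`. -/
def syzygy (F : FreeResolution R M) : FreeResolution R (LinearMap.ker F.aug) where
  rank i := F.rank (i + 1)
  d i := F.d (i + 1)
  aug := (F.d 0).codRestrict _ F.aug_d
  aug_surjective := fun ⟨x, hx⟩ => by
    obtain ⟨y, hy⟩ := (F.exact_zero x).1 hx
    exact ⟨y, Subtype.ext hy⟩
  exact_zero x := by
    rw [← F.exact_succ 0 x, ← Subtype.coe_inj]
    rfl
  exact_succ i := F.exact_succ (i + 1)

lemma IsMinimal.syzygy {F : FreeResolution R M} (hF : F.IsMinimal 𝔪) : F.syzygy.IsMinimal 𝔪 :=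
  fun i => hF (i + 1)

lemma shortExact_syzygy (F : FreeResolution R M) :
    (ShortComplex.mk (ModuleCat.ofHom (LinearMap.ker F.aug).subtype) (ModuleCat.ofHom F.aug)
      (by ext x; exact x.2)).ShortExact :=
  ModuleCat.shortComplex_shortExact _ (LinearMap.exact_subtype_ker_map _) Subtype.val_injective
    F.aug_surjective

lemma IsMinimal.rank_zero_eq_zero (h𝔪 : 𝔪 ≠ ⊤) {F : FreeResolution R M} (hF : F.IsMinimal 𝔪)
    (hM : ∀ x : M, x ∈ 𝔪 • (⊤ : Submodule R M)) : F.rank 0 = 0 := by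
  have htop (x : F.X 0) : x ∈ 𝔪 • (⊤ : Submodule R (F.X 0)) := by
    have hx : x ∈ (𝔪 • (⊤ : Submodule R M)).comap F.aug := hM _
    rw [Submodule.comap_smul_top_of_surjective 𝔪 F.aug F.aug_surjective] at hx
    suffices LinearMap.ker F.aug ≤ 𝔪 • ⊤ from sup_le le_rfl this hx
    intro y hy
    obtain ⟨z, rfl⟩ := (F.exact_zero y).1 hy
    exact hF.d_mem 0 z
  by_contra h0
  let a : Fin (F.rank 0) := ⟨0, Nat.pos_of_ne_zero h0⟩
  refine h𝔪 ((Ideal.eq_top_iff_one 𝔪).2 ?_)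
  simpa using (mem_smul_top_pi_iff 𝔪).1 (htop (Pi.single a 1)) a

lemma IsMinimal.isZero_iff (h𝔪 : 𝔪 ≠ ⊤) {F : FreeResolution R M} (hF : F.IsMinimal 𝔪) :
    Limits.IsZero (ModuleCat.of R M) ↔ F.rank 0 = 0 := by
  rw [ModuleCat.isZero_of_iff_subsingleton]
  refine ⟨fun h => hF.rank_zero_eq_zero h𝔪 fun x => Subsingleton.elim x 0 ▸ zero_mem _, fun h => ?_⟩
  have : IsEmpty (Fin (F.rank 0)) := by rw [h]; infer_instance
  exact F.aug_surjective.subsingleton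

lemma IsMinimal.rank_one_eq_zero (h𝔪 : 𝔪 ≠ ⊤) {F : FreeResolution R M} (hF : F.IsMinimal 𝔪)
    [Module.Projective R M] : F.rank 1 = 0 := by
  obtain ⟨s, hs⟩ := Module.projective_lifting_property F.aug LinearMap.id F.aug_surjective
  let r : F.X 0 →ₗ[R] LinearMap.ker F.aug :=
    (LinearMap.id - s ∘ₗ F.aug).codRestrict _ fun x => by
      simpa [sub_eq_zero] using (LinearMap.congr_fun hs (F.aug x)).symm
  refine hF.syzygy.rank_zero_eq_zero h𝔪 fun x => ?_
  have hrx : r x = x := Subtype.ext (by simp [r])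
  obtain ⟨y, hy⟩ := (F.exact_zero x).1 x.2
  rw [← hrx, ← hy]
  exact Submodule.smul_top_le_comap_smul_top 𝔪 r (hF.d_mem 0 y)

lemma projective_of_rank_one_eq_zero (F : FreeResolution R M) (h : F.rank 1 = 0) :
    Module.Projective R M := by
  have : IsEmpty (Fin (F.rank 1)) := by rw [h]; infer_instance
  have hinj : Function.Injective F.aug := by
    rw [injective_iff_map_eq_zero]
    intro x hx
    obtain ⟨y, rfl⟩ := (F.exact_zero x).1 hx
    rw [Subsingleton.elim y 0, map_zero]
  exact Module.Projective.of_equiv (LinearEquiv.ofBijective F.aug ⟨hinj, F.aug_surjective⟩)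

lemma IsMinimal.hasProjectiveDimensionLE_iff (h𝔪 : 𝔪 ≠ ⊤) {M : Type u} [AddCommGroup M]
    [Module R M] {F : FreeResolution R M} (hF : F.IsMinimal 𝔪) (n : ℕ) :
    HasProjectiveDimensionLE (ModuleCat.of R M) n ↔ F.rank (n + 1) = 0 := by
  induction n generalizing M with
  | zero =>
    rw [← projective_iff_hasProjectiveDimensionLE_zero, ← IsProjective.iff_projective]
    exact ⟨fun _ => hF.rank_one_eq_zero h𝔪, F.projective_of_rank_one_eq_zero⟩
  | succ n ih =>
    have : Projective (ModuleCat.of R (F.X 0)) := inferInstance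
    exact (F.shortExact_syzygy.hasProjectiveDimensionLT_X₃_iff n this).trans (ih hF.syzygy)

lemma IsMinimal.hasProjectiveDimensionLT_iff (h𝔪 : 𝔪 ≠ ⊤) {F : FreeResolution R M}
    (hF : F.IsMinimal 𝔪) (n : ℕ) :
    HasProjectiveDimensionLT (ModuleCat.of R M) n ↔ F.rank n = 0 := by
  cases n with
  | zero => rw [hasProjectiveDimensionLT_zero_iff_isZero, hF.isZero_iff h𝔪]
  | succ n => exact hF.hasProjectiveDimensionLE_iff h𝔪 n

lemma IsMinimal.projDim_eq_iSup (h𝔪 : 𝔪 ≠ ⊤) {F : FreeResolution R M} (hF : F.IsMinimal 𝔪) :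
    projDim R M = ⨆ (n : ℕ) (_ : F.rank n ≠ 0), (n : WithBot ℕ∞) := by
  have natCast_le_iff (n : ℕ) : (n : WithBot ℕ∞) ≤ projDim R M ↔ F.rank n ≠ 0 :=
    (projectiveDimension_ge_iff _ n).trans (hF.hasProjectiveDimensionLT_iff h𝔪 n).not
  exact le_antisymm
    (withBot_enat_le_of_forall_natCast_le fun n hn =>
      le_iSup₂_of_le n ((natCast_le_iff n).1 hn) le_rfl)
    (iSup₂_le fun n hn => (natCast_le_iff n).2 hn)

lemma projDim_eq_iSup_projDim (h𝔪 : 𝔪 ≠ ⊤) {F : FreeResolution R M} (hF : F.IsMinimal 𝔪)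
    {ι : Type*} [Fintype ι] {N : ι → Type u} [∀ l, AddCommGroup (N l)] [∀ l, Module R (N l)]
    {G : ∀ l, FreeResolution R (N l)} (hG : ∀ l, (G l).IsMinimal 𝔪)
    (h : ∀ s, F.rank s = ∑ l, (G l).rank s) : projDim R M = ⨆ l, projDim R (N l) := by
  simp only [hF.projDim_eq_iSup h𝔪, (hG _).projDim_eq_iSup h𝔪]
  rw [iSup_comm]
  simp [h, Finset.sum_eq_zero_iff, iSup_exists]

end FreeResolution

/-- The decomposition `R ^ (a + b) = R ^ a × R ^ b`. -/
def splitEquiv (R : Type*) [CommRing R] (a b : ℕ) :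
    (Fin (a + b) → R) ≃ₗ[R] (Fin a → R) × (Fin b → R) :=
  LinearEquiv.funCongrLeft R R finSumFinEquiv ≪≫ₗ
    LinearEquiv.sumArrowLequivProdArrow (Fin a) (Fin b) R R

lemma splitEquiv_apply {R : Type*} [CommRing R] {a b : ℕ} (x : Fin (a + b) → R) :
    splitEquiv R a b x = (fun i => x (Fin.castAdd b i), fun i => x (Fin.natAdd a i)) := rfl

lemma mem_smul_top_split_iff {R : Type*} [CommRing R] (I : Ideal R) {a b : ℕ}
    (x : Fin (a + b) → R) :
    x ∈ I • (⊤ : Submodule R (Fin (a + b) → R)) ↔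
      (splitEquiv R a b x).1 ∈ I • (⊤ : Submodule R (Fin a → R)) ∧
      (splitEquiv R a b x).2 ∈ I • (⊤ : Submodule R (Fin b → R)) := by
  simp only [mem_smul_top_pi_iff, splitEquiv_apply]
  exact ⟨fun h => ⟨fun i => h _, fun i => h _⟩, fun h i => Fin.addCases h.1 h.2 i⟩

namespace FreeResolution

variable {R : Type u} [CommRing R] {𝔪 : Ideal R} {N N' N'' : Type u} [AddCommGroup N] [Module R N]
  [AddCommGroup N'] [Module R N'] [AddCommGroup N''] [Module R N''] {ι : N' →ₗ[R] N}
  {π : N →ₗ[R] N''}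

/-- The data by which resolutions `F'` and `F''` of the outer terms of a short exact sequence
`0 → N' → N → N'' → 0` are glued to a resolution of `N`: a lift `F'' 0 → N` of the augmentation of
`F''`, and a chain map `conn` of degree `-1` from `F''` to `F'` representing the class of the
extension. The glued resolution is the mapping cone of `conn`. -/
structure Gluing (F' : FreeResolution R N') (F'' : FreeResolution R N'') (ι : N' →ₗ[R] N)
    (π : N →ₗ[R] N'') where
  injective : Function.Injective ι
  exact : Function.Exact ι π
  surjective : Function.Surjective π
  lift : F''.X 0 →ₗ[R] N
  conn : ∀ i, F''.X (i + 1) →ₗ[R] F'.X i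
  proj_lift : ∀ x, π (lift x) = F''.aug x
  incl_aug_conn : ∀ x, ι (F'.aug (conn 0 x)) = lift (F''.d 0 x)
  d_conn : ∀ i x, F'.d i (conn (i + 1) x) = conn i (F''.d (i + 1) x)

namespace Gluing

variable {F' : FreeResolution R N'} {F'' : FreeResolution R N''} (g : Gluing F' F'' ι π)

/-- The differential of the mapping cone, on `F' (i + 1) × F'' (i + 1)`. -/
def coneD (i : ℕ) : F'.X (i + 1) × F''.X (i + 1) →ₗ[R] F'.X i × F''.X i :=
  ((F'.d i).coprod (g.conn i)).prod (-F''.d i ∘ₗ LinearMap.snd R _ _)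

/-- The augmentation of the mapping cone, on `F' 0 × F'' 0`. -/
def coneAug : F'.X 0 × F''.X 0 →ₗ[R] N :=
  (ι ∘ₗ F'.aug).coprod g.lift

lemma coneD_apply (i : ℕ) (x : F'.X (i + 1) × F''.X (i + 1)) :
    g.coneD i x = (F'.d i x.1 + g.conn i x.2, -F''.d i x.2) := rfl

lemma coneAug_apply (x : F'.X 0 × F''.X 0) : g.coneAug x = ι (F'.aug x.1) + g.lift x.2 := rfl

lemma coneAug_surjective : Function.Surjective g.coneAug := by
  intro n
  obtain ⟨y, hy⟩ := F''.aug_surjective (π n)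
  obtain ⟨n', hn'⟩ := (g.exact (n - g.lift y)).1 (by rw [map_sub, g.proj_lift, hy, sub_self])
  obtain ⟨x, rfl⟩ := F'.aug_surjective n'
  exact ⟨(x, y), by rw [coneAug_apply, hn', sub_add_cancel]⟩

lemma exact_coneAug : Function.Exact (g.coneD 0) g.coneAug := by
  rintro ⟨x, y⟩
  constructor
  · intro hxy
    have hy : F''.aug y = 0 := by
      simpa [coneAug_apply, g.proj_lift, g.exact.apply_apply_eq_zero] using congrArg π hxy
    obtain ⟨z, hz⟩ := (F''.exact_zero y).1 hy
    have hx : F'.aug (x + g.conn 0 z) = 0 := g.injective <| by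
      rw [map_add, map_add, g.incl_aug_conn, hz, map_zero]
      exact hxy
    obtain ⟨w, hw⟩ := (F'.exact_zero _).1 hx
    exact ⟨(w, -z), by simp [coneD_apply, hw, hz]⟩
  · rintro ⟨z, hz⟩
    simp [← hz, coneAug_apply, coneD_apply, aug_d, g.incl_aug_conn]

lemma exact_coneD (i : ℕ) : Function.Exact (g.coneD (i + 1)) (g.coneD i) := by
  rintro ⟨x, y⟩
  constructor
  · intro hxy
    obtain ⟨hx, hy⟩ := Prod.mk_eq_zero.1 hxy
    obtain ⟨z, hz⟩ := (F''.exact_succ i y).1 (neg_eq_zero.1 hy)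
    have hxz : F'.d i (x + g.conn (i + 1) z) = 0 := by
      rw [map_add, g.d_conn, hz]
      exact hx
    obtain ⟨w, hw⟩ := (F'.exact_succ i _).1 hxz
    exact ⟨(w, -z), by simp [coneD_apply, hw, hz]⟩
  · rintro ⟨z, hz⟩
    simp [← hz, coneD_apply, d_d, g.d_conn]

/-- The glued resolution of `N`. -/
def resolution : FreeResolution R N where
  rank i := F'.rank i + F''.rank i
  d i := (splitEquiv R _ _).symm.toLinearMap ∘ₗ g.coneD i ∘ₗ (splitEquiv R _ _).toLinearMap
  aug := g.coneAug ∘ₗ (splitEquiv R _ _).toLinearMap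
  aug_surjective := g.coneAug_surjective.comp (splitEquiv R _ _).surjective
  exact_zero := (LinearEquiv.conj_symm_exact_iff_exact _ _ _).2 <|
    (splitEquiv R _ _).surjective.comp_exact_iff_exact.2 g.exact_coneAug
  exact_succ i := (LinearEquiv.conj_symm_exact_iff_exact _ (_ ∘ₗ g.coneD i) _).2 <|
    (splitEquiv R _ _).surjective.comp_exact_iff_exact.2 <|
      (splitEquiv R _ _).symm.injective.comp_exact_iff_exact.2 (g.exact_coneD i)

/-- The decomposition of the terms of the glued resolution. -/
def split (i : ℕ) : g.resolution.X i ≃ₗ[R] F'.X i × F''.X i :=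
  splitEquiv R _ _

lemma split_d (i : ℕ) (x : g.resolution.X (i + 1)) :
    g.split i (g.resolution.d i x) = g.coneD i (g.split (i + 1) x) :=
  (splitEquiv R _ _).apply_symm_apply _

lemma mem_smul_top_iff (I : Ideal R) (i : ℕ) (x : g.resolution.X i) :
    x ∈ I • (⊤ : Submodule R (g.resolution.X i)) ↔
      (g.split i x).1 ∈ I • (⊤ : Submodule R (F'.X i)) ∧
      (g.split i x).2 ∈ I • (⊤ : Submodule R (F''.X i)) :=
  mem_smul_top_split_iff I _

lemma isMinimal (hF' : F'.IsMinimal 𝔪) (hF'' : F''.IsMinimal 𝔪)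
    (hg : ∀ i x, g.conn i x ∈ 𝔪 • (⊤ : Submodule R (F'.X i))) : g.resolution.IsMinimal 𝔪 := by
  rintro i _ ⟨x, rfl⟩
  rw [mem_smul_top_iff, split_d]
  exact ⟨add_mem (hF'.d_mem _ _) (hg _ _), neg_mem (hF''.d_mem _ _)⟩

lemma exists_coneD_eq (hF' : F'.IsLinear 𝔪) (hF'' : F''.IsLinear 𝔪)
    (hg : ∀ i x, g.conn i x ∈ 𝔪 • (⊤ : Submodule R (F'.X i))) {i q : ℕ} {x : F'.X (i + 1)}
    {y : F''.X (i + 1)}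
    (hx : F'.d i x + g.conn i y ∈ 𝔪 ^ (q + 1) • (⊤ : Submodule R (F'.X i)))
    (hy : F''.d i y ∈ 𝔪 ^ (q + 1) • (⊤ : Submodule R (F''.X i))) :
    ∃ w ∈ 𝔪 ^ q • (⊤ : Submodule R (F'.X (i + 1))),
      ∃ v ∈ 𝔪 ^ q • (⊤ : Submodule R (F''.X (i + 1))), g.coneD i (w, v) = g.coneD i (x, y) := by
  obtain ⟨v, hv, hvy⟩ := hF'' i q y hy
  obtain ⟨z, hz⟩ := (F''.exact_succ i (y - v)).1 (by rw [map_sub, hvy, sub_self])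
  have hxz : F'.d i (x + g.conn (i + 1) z) = F'.d i x + g.conn i y - g.conn i v := by
    rw [map_add, g.d_conn, hz, map_sub, add_sub_assoc]
  obtain ⟨w, hw, hwx⟩ := hF' i q (x + g.conn (i + 1) z) <| by
    rw [hxz]
    exact sub_mem hx (map_mem_pow_succ_smul_top (hg i) hv)
  exact ⟨w, hw, v, hv, by simp [coneD_apply, hwx, hxz, hvy]⟩

lemma isLinear (hF' : F'.IsLinear 𝔪) (hF'' : F''.IsLinear 𝔪)
    (hg : ∀ i x, g.conn i x ∈ 𝔪 • (⊤ : Submodule R (F'.X i))) : g.resolution.IsLinear 𝔪 := by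
  intro i q x hx
  rw [mem_smul_top_iff, split_d] at hx
  obtain ⟨w, hw, v, hv, hwv⟩ := g.exists_coneD_eq hF' hF'' hg hx.1 (neg_mem_iff.1 hx.2)
  refine ⟨(g.split (i + 1)).symm (w, v), ?_, (g.split i).injective ?_⟩
  · rw [mem_smul_top_iff, LinearEquiv.apply_symm_apply]
    exact ⟨hw, hv⟩
  · rw [split_d, split_d, LinearEquiv.apply_symm_apply]
    exact hwv

end Gluing
end FreeResolution

lemma iSupIndep_addSubgroup_comap {Γ L N : Type*} [AddCommGroup L] [AddCommGroup N]
    {𝒩 : Γ → AddSubgroup N} (h𝒩 : iSupIndep 𝒩) {f : L →+ N} (hf : Function.Injective f) :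
    iSupIndep fun j => (𝒩 j).comap f := by
  refine fun j => AddSubgroup.disjoint_def.2 fun {x} hx hx' => hf ?_
  have hle : ⨆ i, ⨆ (_ : i ≠ j), (𝒩 i).comap f ≤ (⨆ i, ⨆ (_ : i ≠ j), 𝒩 i).comap f :=
    iSup₂_le fun i hi => AddSubgroup.comap_mono (le_iSup₂_of_le i hi le_rfl)
  rw [map_zero]
  exact AddSubgroup.disjoint_def.1 (h𝒩 j) hx (hle hx')

section Gradings

variable {Γ σ : Type*} [AddCommGroup Γ] {R : Type*} [CommRing R] [SetLike σ R]
  [AddSubgroupClass σ R] (𝒜 : Γ → σ) {κ : Type*} {N : Type*} [AddCommGroup N] [Module R N]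
  {𝒩 : Γ → AddSubgroup N}

/-- The component of degree `j` of the graded free module `⨁_a R(-δ a)`, in which the basis vector
`e_a` has degree `δ a`. -/
def freePiece (δ : κ → Γ) (j : Γ) : AddSubgroup (κ → R) where
  carrier := {x | ∀ a, x a ∈ 𝒜 (j - δ a)}
  add_mem' hx hy a := add_mem (hx a) (hy a)
  zero_mem' _ := zero_mem _
  neg_mem' hx a := neg_mem (hx a)

instance gradedSMul_freePiece [SetLike.GradedMonoid 𝒜] (δ : κ → Γ) :
    SetLike.GradedSMul 𝒜 (freePiece 𝒜 δ) where
  smul_mem _ j _ x hr hx a := by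
    have := SetLike.mul_mem_graded hr (hx a)
    rwa [← add_sub_assoc] at this

variable {𝒜}

lemma map_mem_of_mem_freePiece [Finite κ] [DecidableEq κ] [SetLike.GradedSMul 𝒜 𝒩] {δ : κ → Γ}
    {f : (κ → R) →ₗ[R] N} {c : Γ} (hf : ∀ a, f (Pi.single a 1) ∈ 𝒩 (δ a + c)) {j : Γ} {x : κ → R}
    (hx : x ∈ freePiece 𝒜 δ j) : f x ∈ 𝒩 (j + c) := by
  have := Fintype.ofFinite κ
  rw [linearMap_pi_apply]
  refine sum_mem fun a _ => ?_
  have := SetLike.GradedSMul.smul_mem (hx a) (hf a)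
  rwa [vadd_eq_add, ← add_assoc, sub_add_cancel] at this

variable [DecidableEq Γ] [GradedRing 𝒜]

variable (𝒜) in
/-- The projection of the graded free module `⨁_a R(-δ a)` onto its component of degree `j`. -/
def freeComponent (δ : κ → Γ) (j : Γ) : (κ → R) →+ (κ → R) :=
  AddMonoidHom.mk' (fun x a => GradedRing.proj 𝒜 (j - δ a) (x a))
    fun x y => funext fun a => map_add (GradedRing.proj 𝒜 (j - δ a)) (x a) (y a)

lemma freeComponent_apply (δ : κ → Γ) (j : Γ) (x : κ → R) (a : κ) :
    freeComponent 𝒜 δ j x a = GradedRing.proj 𝒜 (j - δ a) (x a) := rfl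

lemma freeComponent_mem (δ : κ → Γ) (j : Γ) (x : κ → R) :
    freeComponent 𝒜 δ j x ∈ freePiece 𝒜 δ j :=
  fun a => SetLike.coe_mem (DirectSum.decompose 𝒜 (x a) (j - δ a))

lemma freeComponent_of_mem {δ : κ → Γ} {j : Γ} {x : κ → R} (hx : x ∈ freePiece 𝒜 δ j) :
    freeComponent 𝒜 δ j x = x :=
  funext fun a => DirectSum.decompose_of_mem_same 𝒜 (hx a)

lemma freeComponent_of_mem_ne {δ : κ → Γ} {i j : Γ} (hij : i ≠ j) {x : κ → R}
    (hx : x ∈ freePiece 𝒜 δ i) : freeComponent 𝒜 δ j x = 0 :=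
  funext fun a => DirectSum.decompose_of_mem_ne 𝒜 (hx a) (sub_left_injective.ne hij)

lemma iSupIndep_freePiece (δ : κ → Γ) : iSupIndep (freePiece 𝒜 δ) := by
  refine fun j => AddSubgroup.disjoint_def.2 fun {x} hx hx' => ?_
  have hle : ⨆ i, ⨆ (_ : i ≠ j), freePiece 𝒜 δ i ≤ (freeComponent 𝒜 δ j).ker :=
    iSup₂_le fun i hi _ => freeComponent_of_mem_ne hi
  rw [← freeComponent_of_mem hx]
  exact hle hx'

lemma sub_proj_smul_mem_iSup [SetLike.GradedSMul 𝒜 𝒩] {i j : Γ} {n : N} (hn : n ∈ 𝒩 (j - i))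
    (r : R) : (r - GradedRing.proj 𝒜 i r) • n ∈ ⨆ l, ⨆ (_ : l ≠ j), 𝒩 l := by
  induction r using DirectSum.Decomposition.inductionOn 𝒜 with
  | zero => simp
  | @homogeneous l r =>
    by_cases hl : l = i
    · subst hl
      simp [GradedRing.proj_apply]
    · rw [GradedRing.proj_apply, DirectSum.decompose_of_mem_ne 𝒜 r.2 hl, sub_zero]
      refine le_iSup₂_of_le (f := fun l (_ : l ≠ j) => 𝒩 l) (l + (j - i)) ?_ le_rfl
        (SetLike.GradedSMul.smul_mem r.2 hn)
      rwa [Ne, add_sub_left_comm, add_eq_left, sub_eq_zero]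
  | add r s hr hs =>
    rw [map_add, add_sub_add_comm, add_smul]
    exact add_mem hr hs

variable [Finite κ] [DecidableEq κ]

lemma map_freeComponent_eq [SetLike.GradedSMul 𝒜 𝒩] (h𝒩 : iSupIndep 𝒩) {δ : κ → Γ}
    {f : (κ → R) →ₗ[R] N} (hf : ∀ a, f (Pi.single a 1) ∈ 𝒩 (δ a)) {j : Γ} {x : κ → R}
    (hx : f x ∈ 𝒩 j) : f (freeComponent 𝒜 δ j x) = f x := by
  have hj : f (freeComponent 𝒜 δ j x) ∈ 𝒩 j := by
    have := map_mem_of_mem_freePiece (c := 0) (fun a => by simpa using hf a)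
      (freeComponent_mem (𝒜 := 𝒜) δ j x)
    rwa [add_zero] at this
  have := Fintype.ofFinite κ
  rw [eq_comm, ← sub_eq_zero]
  refine AddSubgroup.disjoint_def.1 (h𝒩 j) (sub_mem hx hj) ?_
  rw [← map_sub, linearMap_pi_apply]
  exact sum_mem fun a _ => sub_proj_smul_mem_iSup (by simpa using hf a) (x a)

lemma exists_mem_smul_top_mem_freePiece {𝔪 : Ideal R} (h𝔪 : 𝔪.IsHomogeneous 𝒜)
    [SetLike.GradedSMul 𝒜 𝒩] (h𝒩 : iSupIndep 𝒩) {δ : κ → Γ} {f : (κ → R) →ₗ[R] N}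
    (hf : ∀ a, f (Pi.single a 1) ∈ 𝒩 (δ a)) {j : Γ} {x : κ → R}
    (hx𝔪 : x ∈ 𝔪 • (⊤ : Submodule R (κ → R))) (hx : f x ∈ 𝒩 j) :
    ∃ y ∈ 𝔪 • (⊤ : Submodule R (κ → R)), y ∈ freePiece 𝒜 δ j ∧ f y = f x := by
  refine ⟨freeComponent 𝒜 δ j x, ?_, freeComponent_mem δ j x, map_freeComponent_eq h𝒩 hf hx⟩
  rw [mem_smul_top_pi_iff] at hx𝔪 ⊢
  exact fun a => h𝔪 _ (hx𝔪 a)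

end Gradings

lemma splitEquiv_single_castAdd {R : Type*} [CommRing R] {a b : ℕ} (i : Fin a) :
    splitEquiv R a b (Pi.single (Fin.castAdd b i) 1) = (Pi.single i 1, 0) := by
  rw [splitEquiv_apply]
  ext l
  · simp [Pi.single_apply]
  · exact Pi.single_eq_of_ne (Fin.ne_of_val_ne (by grind)) 1

lemma splitEquiv_single_natAdd {R : Type*} [CommRing R] {a b : ℕ} (i : Fin b) :
    splitEquiv R a b (Pi.single (Fin.natAdd a i) 1) = (0, Pi.single i 1) := by
  rw [splitEquiv_apply]
  ext l
  · exact Pi.single_eq_of_ne (Fin.ne_of_val_ne (by grind)) 1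
  · simp [Pi.single_apply]

lemma mem_freePiece_append_iff {Γ σ R : Type*} [AddCommGroup Γ] [CommRing R] [SetLike σ R]
    [AddSubgroupClass σ R] {𝒜 : Γ → σ} {a b : ℕ} {δ : Fin a → Γ} {ε : Fin b → Γ} {c j : Γ}
    {x : Fin (a + b) → R} :
    x ∈ freePiece 𝒜 (Fin.append δ fun i => ε i + c) j ↔
      (splitEquiv R a b x).1 ∈ freePiece 𝒜 δ j ∧
      (splitEquiv R a b x).2 ∈ freePiece 𝒜 ε (j - c) := by
  refine ⟨fun h => ⟨fun i => ?_, fun i => ?_⟩, fun h i => ?_⟩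
  · simpa [splitEquiv_apply] using h (Fin.castAdd b i)
  · simpa [splitEquiv_apply, sub_sub, add_comm] using h (Fin.natAdd a i)
  · induction i using Fin.addCases with
    | left i => simpa [splitEquiv_apply] using h.1 i
    | right i => simpa [splitEquiv_apply, sub_sub, add_comm] using h.2 i

namespace FreeResolution

variable {R : Type u} [CommRing R] {𝔪 : Ideal R} {N N' N'' : Type u} [AddCommGroup N] [Module R N]
  [AddCommGroup N'] [Module R N'] [AddCommGroup N''] [Module R N''] {ι : N' →ₗ[R] N}
  {π : N →ₗ[R] N''} {Γ σ : Type*} [AddCommGroup Γ] [SetLike σ R] [AddSubgroupClass σ R]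
  {𝒜 : Γ → σ} {𝒩 : Γ → AddSubgroup N} {𝒩' : Γ → AddSubgroup N'} {𝒩'' : Γ → AddSubgroup N''}

/-- The basis vectors of `F i` have the degrees `deg i a`, and all the maps preserve degrees: this
is `GradedFreeResolution` as a property, for gradings by an arbitrary group. -/
structure IsGradedBy (F : FreeResolution R N) (𝒜 : Γ → σ) (𝒩 : Γ → AddSubgroup N)
    (deg : ∀ i, Fin (F.rank i) → Γ) : Prop where
  d_mem : ∀ i a, F.d i (Pi.single a 1) ∈ freePiece 𝒜 (deg i) (deg (i + 1) a)
  aug_mem : ∀ a, F.aug (Pi.single a 1) ∈ 𝒩 (deg 0 a)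

variable {F' : FreeResolution R N'} {F'' : FreeResolution R N''}

namespace Gluing

/-- The degrees of the basis of the glued resolution, when the map `π` lowers degrees by `c`. -/
def deg (g : Gluing F' F'' ι π) (deg' : ∀ i, Fin (F'.rank i) → Γ)
    (deg'' : ∀ i, Fin (F''.rank i) → Γ) (c : Γ) (i : ℕ) : Fin (g.resolution.rank i) → Γ :=
  Fin.append (deg' i) fun a => deg'' i a + c

/-- The maps that define the gluing preserve degrees, up to the shift by `c` on `F''`. -/
structure IsGradedBy (g : Gluing F' F'' ι π) (𝒜 : Γ → σ) (𝒩 : Γ → AddSubgroup N)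
    (deg' : ∀ i, Fin (F'.rank i) → Γ) (deg'' : ∀ i, Fin (F''.rank i) → Γ) (c : Γ) : Prop where
  lift_mem : ∀ a, g.lift (Pi.single a 1) ∈ 𝒩 (deg'' 0 a + c)
  conn_mem : ∀ i a, g.conn i (Pi.single a 1) ∈ freePiece 𝒜 (deg' i) (deg'' (i + 1) a + c)

lemma split_single_castAdd (g : Gluing F' F'' ι π) (i : ℕ) (a : Fin (F'.rank i)) :
    g.split i (Pi.single (Fin.castAdd _ a) 1) = (Pi.single a 1, 0) :=
  splitEquiv_single_castAdd a

lemma split_single_natAdd (g : Gluing F' F'' ι π) (i : ℕ) (a : Fin (F''.rank i)) :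
    g.split i (Pi.single (Fin.natAdd _ a) 1) = (0, Pi.single a 1) :=
  splitEquiv_single_natAdd a

lemma aug_apply (g : Gluing F' F'' ι π) (x : g.resolution.X 0) :
    g.resolution.aug x = g.coneAug (g.split 0 x) := rfl

lemma mem_freePiece_deg_iff (g : Gluing F' F'' ι π) {deg' : ∀ i, Fin (F'.rank i) → Γ}
    {deg'' : ∀ i, Fin (F''.rank i) → Γ} {c : Γ} {i : ℕ} {j : Γ} {x : g.resolution.X i} :
    x ∈ freePiece 𝒜 (g.deg deg' deg'' c i) j ↔
      (g.split i x).1 ∈ freePiece 𝒜 (deg' i) j ∧ (g.split i x).2 ∈ freePiece 𝒜 (deg'' i) (j - c) :=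
  mem_freePiece_append_iff

lemma IsGradedBy.resolution {g : Gluing F' F'' ι π} {deg' : ∀ i, Fin (F'.rank i) → Γ}
    {deg'' : ∀ i, Fin (F''.rank i) → Γ} {c : Γ} (hg : g.IsGradedBy 𝒜 𝒩 deg' deg'' c)
    (hι : ∀ j, ∀ x ∈ 𝒩' j, ι x ∈ 𝒩 j) (hF' : F'.IsGradedBy 𝒜 𝒩' deg')
    (hF'' : F''.IsGradedBy 𝒜 𝒩'' deg'') :
    g.resolution.IsGradedBy 𝒜 𝒩 (g.deg deg' deg'' c) where
  d_mem i a := by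
    rw [mem_freePiece_deg_iff, split_d]
    induction a using Fin.addCases with
    | left a =>
      rw [split_single_castAdd, coneD_apply, deg, Fin.append_left]
      exact ⟨by simpa using hF'.d_mem i a, by simp⟩
    | right a =>
      rw [split_single_natAdd, coneD_apply, deg, Fin.append_right]
      simpa using ⟨hg.conn_mem i a, hF''.d_mem i a⟩
  aug_mem a := by
    induction a using Fin.addCases with
    | left a =>
      rw [aug_apply, split_single_castAdd, coneAug_apply, deg, Fin.append_left]
      simpa using hι _ _ (hF'.aug_mem a)
    | right a =>
      rw [aug_apply, split_single_natAdd, coneAug_apply, deg, Fin.append_right]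
      simpa using hg.lift_mem a

end Gluing

lemma IsGradedBy.syzygy {F : FreeResolution R N} {deg : ∀ i, Fin (F.rank i) → Γ}
    (hF : F.IsGradedBy 𝒜 𝒩 deg) :
    F.syzygy.IsGradedBy 𝒜
      (fun j => (freePiece 𝒜 (deg 0) j).comap (LinearMap.ker F.aug).subtype.toAddMonoidHom)
      fun i => deg (i + 1) :=
  ⟨fun i => hF.d_mem (i + 1), hF.d_mem 0⟩

variable [DecidableEq Γ] [GradedRing 𝒜] [SetLike.GradedSMul 𝒜 𝒩']

lemma exists_isLift_mem_smul_top (h𝔪 : 𝔪.IsHomogeneous 𝒜) (h𝒩' : iSupIndep 𝒩')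
    {deg' : ∀ i, Fin (F'.rank i) → Γ} {deg'' : ∀ i, Fin (F''.rank i) → Γ} {c : Γ}
    (hF' : F'.IsLinear 𝔪) (hgr' : F'.IsGradedBy 𝒜 𝒩' deg') (hF'' : F''.IsMinimal 𝔪)
    (hgr'' : F''.IsGradedBy 𝒜 𝒩'' deg'') {f : N'' →ₗ[R] N'}
    (hf𝔪 : ∀ x, f x ∈ 𝔪 • (⊤ : Submodule R N')) (hf : ∀ j, ∀ x ∈ 𝒩'' j, f x ∈ 𝒩' (j + c)) :
    ∃ α, IsLift f F'' F' α ∧ (∀ i x, α i x ∈ 𝔪 • (⊤ : Submodule R (F'.X i))) ∧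
      ∀ i a, α i (Pi.single a 1) ∈ freePiece 𝒜 (deg' i) (deg'' i a + c) := by
  suffices ∃ α, IsLift f F'' F' α ∧ ∀ i a, α i (Pi.single a 1) ∈
      {y | y ∈ 𝔪 • (⊤ : Submodule R (F'.X i)) ∧ y ∈ freePiece 𝒜 (deg' i) (deg'' i a + c)} by
    obtain ⟨α, hα, hmem⟩ := this
    exact ⟨α, hα, fun i => linearMap_pi_apply_mem fun a => (hmem i a).1, fun i a => (hmem i a).2⟩
  refine exists_isLift_mem f F'' F' _ (fun a => ?_) fun i φ hφ a h => ?_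
  · have hfa := hf𝔪 (F''.aug (Pi.single a 1))
    rw [← LinearMap.range_eq_top.2 F'.aug_surjective, ← Submodule.map_top, ← Submodule.map_smul'']
      at hfa
    obtain ⟨y, hy𝔪, hy⟩ := hfa
    obtain ⟨z, hz𝔪, hz, hzy⟩ := exists_mem_smul_top_mem_freePiece h𝔪 h𝒩' hgr'.aug_mem hy𝔪
      (hy ▸ hf _ _ (hgr''.aug_mem a))
    exact ⟨z, ⟨hz𝔪, hz⟩, hzy.trans hy⟩
  · have hφ𝔪 : φ (F''.d i (Pi.single a 1)) ∈ 𝔪 ^ 2 • (⊤ : Submodule R (F'.X i)) :=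
      map_mem_pow_succ_smul_top (linearMap_pi_apply_mem fun b => (hφ b).1)
        ((pow_one 𝔪).symm ▸ hF''.d_mem i _)
    obtain ⟨y₀, hy₀⟩ := h
    obtain ⟨y, hy𝔪, hy⟩ := hF' i 1 y₀ (hy₀ ▸ hφ𝔪)
    have hdeg : F'.d i y ∈ freePiece 𝒜 (deg' i) (deg'' (i + 1) a + c) := by
      rw [hy, hy₀]
      exact map_mem_of_mem_freePiece (fun b => (hφ b).2) (hgr''.d_mem i a)
    obtain ⟨z, hz𝔪, hz, hzy⟩ := exists_mem_smul_top_mem_freePiece h𝔪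
      (iSupIndep_freePiece (deg' i)) (hgr'.d_mem i) (pow_one 𝔪 ▸ hy𝔪) hdeg
    exact ⟨z, ⟨hz𝔪, hz⟩, hzy.trans (hy.trans hy₀)⟩

lemma exists_gluing [SetLike.GradedSMul 𝒜 𝒩] (h𝔪 : 𝔪.IsHomogeneous 𝒜) (h𝒩' : iSupIndep 𝒩')
    (hinj : Function.Injective ι) (hexact : Function.Exact ι π) (hsurj : Function.Surjective π)
    {c : Γ} (hι : ∀ j x, ι x ∈ 𝒩 j → x ∈ 𝒩' j) (hπ : ∀ j, ∀ y ∈ 𝒩'' j, ∃ x ∈ 𝒩 (j + c), π x = y)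
    (hι𝔪 : ∀ x, ι x ∈ 𝔪 • (⊤ : Submodule R N) → x ∈ 𝔪 • (⊤ : Submodule R N'))
    {deg' : ∀ i, Fin (F'.rank i) → Γ} {deg'' : ∀ i, Fin (F''.rank i) → Γ}
    (hF' : F'.IsLinear 𝔪) (hgr' : F'.IsGradedBy 𝒜 𝒩' deg') (hF'' : F''.IsMinimal 𝔪)
    (hgr'' : F''.IsGradedBy 𝒜 𝒩'' deg'') :
    ∃ g : Gluing F' F'' ι π, (∀ i x, g.conn i x ∈ 𝔪 • (⊤ : Submodule R (F'.X i))) ∧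
      g.IsGradedBy 𝒜 𝒩 deg' deg'' c := by
  obtain ⟨lift, hlift, hπlift⟩ := exists_linearMap_pi_comp_eq (p := π) (f := F''.aug)
    (fun a => 𝒩 (deg'' 0 a + c)) fun a => hπ _ _ (hgr''.aug_mem a)
  have hker (x : LinearMap.ker F''.aug) : lift x ∈ LinearMap.range ι :=
    (hexact _).1 ((hπlift x).trans x.2)
  let f : LinearMap.ker F''.aug →ₗ[R] N' :=
    (LinearEquiv.ofInjective ι hinj).symm.toLinearMap ∘ₗ
      (lift ∘ₗ (LinearMap.ker F''.aug).subtype).codRestrict _ hker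
  have hf (x) : ι (f x) = lift x :=
    congrArg Subtype.val ((LinearEquiv.ofInjective ι hinj).apply_symm_apply ⟨lift x, hker x⟩)
  have hf𝔪 (x) : f x ∈ 𝔪 • (⊤ : Submodule R N') := by
    obtain ⟨y, hy⟩ := (F''.exact_zero x).1 x.2
    refine hι𝔪 _ ?_
    rw [hf, ← hy]
    exact Submodule.smul_top_le_comap_smul_top 𝔪 lift (hF''.d_mem 0 y)
  obtain ⟨conn, hconn, hconn𝔪, hconn_deg⟩ := exists_isLift_mem_smul_top h𝔪 h𝒩' hF' hgr'
    hF''.syzygy hgr''.syzygy hf𝔪 fun j x hx => hι _ _ (hf x ▸ map_mem_of_mem_freePiece hlift hx)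
  exact ⟨{  injective := hinj
            exact := hexact
            surjective := hsurj
            lift := lift
            conn := conn
            proj_lift := hπlift
            incl_aug_conn := fun x => (congrArg ι (hconn.aug_apply x)).trans (hf _)
            d_conn := hconn.d_apply },
    hconn𝔪, hlift, hconn_deg⟩

end FreeResolution

instance gradedSMul_comap_subtype {Γ σ R N : Type*} [AddCommGroup Γ] [CommRing R] [SetLike σ R]
    [AddCommGroup N] [Module R N] (𝒜 : Γ → σ) (𝒩 : Γ → AddSubgroup N) [SetLike.GradedSMul 𝒜 𝒩]
    (L : Submodule R N) :
    SetLike.GradedSMul 𝒜 fun j => (𝒩 j).comap L.subtype.toAddMonoidHom where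
  smul_mem _ _ _ _ hr hx := SetLike.GradedSMul.smul_mem (A := 𝒜) (B := 𝒩) hr hx

lemma card_append_eq {Γ : Type*} [AddCommGroup Γ] [DecidableEq Γ] {a b : ℕ} (δ : Fin a → Γ)
    (ε : Fin b → Γ) (c j : Γ) :
    Fintype.card {i // Fin.append δ (fun i => ε i + c) i = j} =
      Fintype.card {i // δ i = j} + Fintype.card {i // ε i = j - c} := by
  simp only [Fintype.card_subtype, Finset.card_filter, Fin.sum_univ_add, Fin.append_left,
    Fin.append_right, eq_sub_iff_add_eq]

section Initial

variable {R : Type u} [CommRing R] {M : Type u} [AddCommGroup M] [Module R M] {t : ℕ}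
  {m : Fin t → M} {𝔪 : Ideal R}

lemma fintype_linearCombination_coe {κ : Type*} [Fintype κ] (m : κ → M) (c : κ →₀ R) :
    Fintype.linearCombination R m c = Finsupp.linearCombination R m c := by
  rw [Finsupp.linearCombination_apply, Finsupp.sum_fintype c (fun i r => r • m i)
    fun _ => zero_smul R _, Fintype.linearCombination_apply]

lemma span_image_inf_smul_span_range_le {κ : Type*} [Fintype κ] {m : κ → M}
    (hrel : ∀ b, Fintype.linearCombination R m b = 0 → ∀ j, b j ∈ 𝔪) (s : Set κ) :
    Submodule.span R (m '' s) ⊓ 𝔪 • Submodule.span R (Set.range m) ≤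
      𝔪 • Submodule.span R (m '' s) := by
  rintro x ⟨hx, hx𝔪⟩
  obtain ⟨b, hbs, rfl⟩ := (Finsupp.mem_span_image_iff_linearCombination R).1 hx
  rw [← Fintype.range_linearCombination, ← Submodule.map_top, ← Submodule.map_smul''] at hx𝔪
  obtain ⟨c, hc, hcb⟩ := hx𝔪
  have hb (j : κ) : b j ∈ 𝔪 := by
    have h := hrel (b - c) (by rw [map_sub, hcb, fintype_linearCombination_coe, sub_self]) j
    exact (Submodule.sub_mem_iff_left 𝔪 ((mem_smul_top_pi_iff 𝔪).1 hc j)).1 h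
  exact sum_mem fun j hj => Submodule.smul_mem_smul (hb j)
    (Submodule.subset_span ⟨j, hbs hj, rfl⟩)

lemma mem_colonIdeal_iff {l : Fin t} {r : R} : r ∈ colonIdeal R m l ↔ r • m l ∈ initial R m l :=
  Submodule.mem_colon_singleton

lemma initial_mono {i j : ℕ} (h : i ≤ j) : initial R m i ≤ initial R m j :=
  Submodule.span_mono (Set.image_mono fun _ ha => lt_of_lt_of_le ha h)

lemma mem_initial_of_lt {i : ℕ} {l : Fin t} (h : (l : ℕ) < i) : m l ∈ initial R m i :=
  Submodule.subset_span ⟨l, h, rfl⟩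

lemma initial_zero : initial R m 0 = ⊥ := by
  simp [initial]

lemma initial_self : initial R m t = Submodule.span R (Set.range m) := by
  simp [initial]

lemma initial_succ (l : Fin t) :
    initial R m (l + 1) = initial R m l ⊔ Submodule.span R {m l} := by
  rw [initial, initial, ← Submodule.span_union, ← Set.image_singleton, ← Set.image_union]
  congr 2
  ext j
  simp only [Set.mem_ofPred_eq, Set.mem_union, Set.mem_singleton_iff, Fin.ext_iff]
  omega

lemma mem_smul_top_of_inclusion_mem
    (hrel : ∀ b, Fintype.linearCombination R m b = 0 → ∀ j, b j ∈ 𝔪) {i j : ℕ} (hij : i ≤ j)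
    {x : initial R m i} (hx : Submodule.inclusion (initial_mono hij) x ∈
      𝔪 • (⊤ : Submodule R (initial R m j))) :
    x ∈ 𝔪 • (⊤ : Submodule R (initial R m i)) := by
  rw [Submodule.mem_smul_top_iff] at hx ⊢
  exact span_image_inf_smul_span_range_le hrel _
    ⟨x.2, smul_mono_right 𝔪 (Submodule.span_mono (Set.image_subset_range _ _)) hx⟩

lemma exists_proj_initial (m : Fin t → M) (l : Fin t) :
    ∃ π : initial R m (l + 1) →ₗ[R] R ⧸ colonIdeal R m l,
      Function.Exact (Submodule.inclusion (initial_mono (Nat.le_succ l))) π ∧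
      ∀ r, π (r • ⟨m l, mem_initial_of_lt (Nat.lt_succ_self l)⟩) = Submodule.Quotient.mk r := by
  set N' := (initial R m l).submoduleOf (initial R m (l + 1))
  let w : initial R m (l + 1) := ⟨m l, mem_initial_of_lt (Nat.lt_succ_self l)⟩
  let φ : R →ₗ[R] initial R m (l + 1) ⧸ N' := N'.mkQ ∘ₗ LinearMap.toSpanSingleton R _ w
  have hker : colonIdeal R m l = LinearMap.ker φ := by
    ext r
    exact mem_colonIdeal_iff.trans (Submodule.Quotient.mk_eq_zero N' (x := r • w)).symm
  have hφ : Function.Surjective φ := by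
    rintro ⟨x, hx⟩
    have hx' : x ∈ initial R m l ⊔ Submodule.span R {m l} := initial_succ (R := R) (m := m) l ▸ hx
    obtain ⟨y, hy, z, hz, rfl⟩ := Submodule.mem_sup.1 hx'
    obtain ⟨r, rfl⟩ := Submodule.mem_span_singleton.1 hz
    refine ⟨r, (Submodule.Quotient.eq N').2 ?_⟩
    change r • m l - (y + r • m l) ∈ initial R m l
    rwa [sub_add_cancel_right, neg_mem_iff]
  let e : (R ⧸ colonIdeal R m l) ≃ₗ[R] initial R m (l + 1) ⧸ N' :=
    Submodule.quotEquivOfEq _ _ hker ≪≫ₗ φ.quotKerEquivOfSurjective hφ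
  refine ⟨e.symm.toLinearMap ∘ₗ N'.mkQ, fun x => ?_, fun r => ?_⟩
  · refine (e.symm.map_eq_zero_iff.trans (Submodule.Quotient.mk_eq_zero N')).trans
      ⟨fun hx => ⟨⟨x, hx⟩, rfl⟩, ?_⟩
    rintro ⟨y, rfl⟩
    exact y.2
  · exact e.symm_apply_eq.2 rfl

namespace FreeResolution

/-- The resolution of a zero module by zero modules. -/
def zero (R : Type u) [CommRing R] (N : Type u) [AddCommGroup N] [Module R N] [Subsingleton N] :
    FreeResolution R N where
  rank _ := 0
  d _ := 0
  aug := 0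
  aug_surjective _ := ⟨0, Subsingleton.elim _ _⟩
  exact_zero _ := ⟨fun _ => ⟨0, Subsingleton.elim _ _⟩, fun _ => rfl⟩
  exact_succ _ _ := ⟨fun _ => ⟨0, Subsingleton.elim _ _⟩, fun _ => rfl⟩

end FreeResolution

theorem exists_isGradedBy_resolution_initial {Γ σ : Type*} [AddCommGroup Γ] [DecidableEq Γ]
    [SetLike σ R] [AddSubgroupClass σ R] {𝒜 : Γ → σ} [GradedRing 𝒜] {ℳ : Γ → AddSubgroup M}
    [SetLike.GradedSMul 𝒜 ℳ] (h𝔪 : 𝔪.IsHomogeneous 𝒜) (hℳ : iSupIndep ℳ) {d : Fin t → Γ}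
    (hm : ∀ l, m l ∈ ℳ (d l)) (hrel : ∀ b, Fintype.linearCombination R m b = 0 → ∀ j, b j ∈ 𝔪)
    {G : ∀ l, FreeResolution R (R ⧸ colonIdeal R m l)} {δ : ∀ l i, Fin ((G l).rank i) → Γ}
    (hmin : ∀ l, (G l).IsMinimal 𝔪) (hlin : ∀ l, (G l).IsLinear 𝔪)
    (hgr : ∀ l, (G l).IsGradedBy 𝒜 (fun j => (AddSubgroup.ofClass (𝒜 j)).map
      (Submodule.mkQ (colonIdeal R m l)).toAddMonoidHom) (δ l))
    (i : ℕ) (hi : i ≤ t) :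
    ∃ (F : FreeResolution R (initial R m i)) (deg : ∀ s, Fin (F.rank s) → Γ),
      F.IsMinimal 𝔪 ∧ F.IsLinear 𝔪 ∧
      F.IsGradedBy 𝒜 (fun j => (ℳ j).comap (initial R m i).subtype.toAddMonoidHom) deg ∧
      (∀ s, F.rank s = ∑ l : Fin i, (G (l.castLE hi)).rank s) ∧
      ∀ s j, Fintype.card {a // deg s a = j} =
        ∑ l : Fin i, Fintype.card {a // δ (l.castLE hi) s a = j - d (l.castLE hi)} := by
  induction i with
  | zero =>
    have : Subsingleton (initial R m 0) := by rw [initial_zero]; infer_instance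
    have : ∀ s, IsEmpty (Fin ((FreeResolution.zero R (initial R m 0)).rank s)) := fun _ =>
      inferInstanceAs (IsEmpty (Fin 0))
    refine ⟨FreeResolution.zero R _, fun _ => isEmptyElim, ?_, fun _ _ _ _ => ⟨0, zero_mem _, rfl⟩,
      ⟨fun _ => isEmptyElim, isEmptyElim⟩, fun s => rfl, fun s j => by simp⟩
    rintro i _ ⟨x, rfl⟩
    exact zero_mem _
  | succ i ih =>
    obtain ⟨F, deg, hFmin, hFlin, hFgr, hrank, hcount⟩ := ih (Nat.le_of_succ_le hi)
    let l : Fin t := ⟨i, hi⟩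
    obtain ⟨π, hexact, hπ⟩ := exists_proj_initial (R := R) m l
    obtain ⟨g, hg𝔪, hggr⟩ := FreeResolution.exists_gluing (c := d l)
      (𝒩 := fun j => (ℳ j).comap (initial R m (l + 1)).subtype.toAddMonoidHom) h𝔪
      (iSupIndep_addSubgroup_comap hℳ Subtype.val_injective) (Submodule.inclusion_injective _)
      hexact (fun y => (Submodule.Quotient.mk_surjective _ y).elim fun r hr => ⟨_, (hπ r).trans hr⟩)
      (fun _ _ hx => hx)
      (by
        rintro j _ ⟨r, hr, rfl⟩
        exact ⟨_, SetLike.GradedSMul.smul_mem (A := 𝒜) (B := ℳ) hr (hm l), hπ r⟩)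
      (fun _ => mem_smul_top_of_inclusion_mem hrel (Nat.le_succ i)) hFlin hFgr (hmin l) (hgr l)
    refine ⟨g.resolution, g.deg deg (δ l) (d l), g.isMinimal hFmin (hmin l) hg𝔪,
      g.isLinear hFlin (hlin l) hg𝔪, hggr.resolution (fun _ _ hx => hx) hFgr (hgr l),
      fun s => ?_, fun s j => ?_⟩
    · rw [Fin.sum_univ_castSucc]
      exact congrArg (· + (G l).rank s) (hrank s)
    · rw [Fin.sum_univ_castSucc]
      exact (card_append_eq _ _ _ _).trans (congrArg (· + _) (hcount s j))

end Initial

section ConnectedGraded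

variable {k : Type v} [Field k] {R : Type u} [CommRing R] [Algebra k R] {𝒜 : ℤ → Submodule k R}

/-- `R = ⨁ R_n` is a nonnegatively graded `k`-algebra with `R_0 = k`. -/
structure IsConnectedGraded (𝒜 : ℤ → Submodule k R) : Prop where
  nontrivial : Nontrivial R
  neg : ∀ n < 0, 𝒜 n = ⊥
  zero : ∀ x ∈ 𝒜 0, ∃ c : k, algebraMap k R c = x

lemma IsStandardGraded.isConnectedGraded (h : IsStandardGraded 𝒜) : IsConnectedGraded 𝒜 :=
  ⟨h.nontrivial, h.neg, h.zero⟩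

lemma gradedMaximalIdeal_isHomogeneous [GradedAlgebra 𝒜] :
    (gradedMaximalIdeal 𝒜).IsHomogeneous 𝒜 :=
  Ideal.homogeneous_span 𝒜 _ fun _ ⟨n, _, hx⟩ => ⟨n, hx⟩

namespace IsConnectedGraded

lemma mem_gradedMaximalIdeal (h : IsConnectedGraded 𝒜) {x : R} {n : ℤ} (hx : x ∈ 𝒜 n)
    (hn : n ≠ 0) : x ∈ gradedMaximalIdeal 𝒜 := by
  rcases hn.lt_or_gt with hn | hn
  · rw [h.neg n hn, Submodule.mem_bot] at hx
    exact hx ▸ zero_mem _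
  · exact Ideal.subset_span ⟨n, hn, hx⟩

variable [GradedAlgebra 𝒜]

lemma proj_zero_eq_zero (h : IsConnectedGraded 𝒜) {x : R} (hx : x ∈ gradedMaximalIdeal 𝒜) :
    GradedRing.proj 𝒜 0 x = 0 := by
  induction hx using Submodule.closure_induction with
  | zero => exact map_zero _
  | add x y _ _ hx hy => rw [map_add, hx, hy, add_zero]
  | smul_mem r x hx =>
    obtain ⟨n, hn, hx⟩ := hx
    have hr : GradedRing.proj 𝒜 (-n) r = 0 :=
      (Submodule.mem_bot k).1 (h.neg (-n) (neg_lt_zero.2 hn) ▸ SetLike.coe_mem _)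
    have := DirectSum.coe_decompose_mul_add_of_right_mem 𝒜 (i := -n) (a := r) hx
    rw [neg_add_cancel] at this
    exact this.trans (by rw [← GradedRing.proj_apply, hr, zero_mul])

lemma sub_proj_zero_mem (h : IsConnectedGraded 𝒜) (x : R) :
    x - GradedRing.proj 𝒜 0 x ∈ gradedMaximalIdeal 𝒜 := by
  induction x using DirectSum.Decomposition.inductionOn 𝒜 with
  | zero => simp
  | @homogeneous n x =>
    by_cases hn : n = 0
    · subst hn
      simp [GradedRing.proj_apply]
    · rw [GradedRing.proj_apply, DirectSum.decompose_of_mem_ne 𝒜 x.2 hn, sub_zero]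
      exact h.mem_gradedMaximalIdeal x.2 hn
  | add x y hx hy =>
    rw [map_add, add_sub_add_comm]
    exact add_mem hx hy

lemma gradedMaximalIdeal_ne_top (h : IsConnectedGraded 𝒜) : gradedMaximalIdeal 𝒜 ≠ ⊤ := by
  have := h.nontrivial
  intro htop
  have h1 := h.proj_zero_eq_zero (x := 1) (htop ▸ Submodule.mem_top)
  rw [GradedRing.proj_apply,
    DirectSum.decompose_of_mem_same 𝒜 SetLike.GradedOne.one_mem] at h1
  exact one_ne_zero h1

lemma eq_zero_of_algebraMap_mem (h : IsConnectedGraded 𝒜) {c : k}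
    (hc : algebraMap k R c ∈ gradedMaximalIdeal 𝒜) : c = 0 := by
  by_contra h0
  exact h.gradedMaximalIdeal_ne_top
    (Ideal.eq_top_of_isUnit_mem _ hc ((isUnit_iff_ne_zero.2 h0).map (algebraMap k R)))

lemma isUnit_proj_zero (h : IsConnectedGraded 𝒜) {x : R} (hx : x ∉ gradedMaximalIdeal 𝒜) :
    IsUnit (GradedRing.proj 𝒜 0 x) := by
  obtain ⟨c, hc⟩ := h.zero (GradedRing.proj 𝒜 0 x) (SetLike.coe_mem _)
  rw [← hc]
  refine (isUnit_iff_ne_zero.2 ?_).map _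
  rintro rfl
  have := h.sub_proj_zero_mem x
  rw [← hc, map_zero, sub_zero] at this
  exact hx this

end IsConnectedGraded

end ConnectedGraded

namespace FreeResolution

lemma IsGradedBy.exists_isLift {Γ σ : Type*} [AddCommGroup Γ] [DecidableEq Γ] {R : Type u}
    [CommRing R] [SetLike σ R] [AddSubgroupClass σ R] {𝒜 : Γ → σ} [GradedRing 𝒜] {N : Type u}
    [AddCommGroup N] [Module R N] {𝒩 : Γ → AddSubgroup N} [SetLike.GradedSMul 𝒜 𝒩]
    (h𝒩 : iSupIndep 𝒩) {F G : FreeResolution R N} {δ : ∀ i, Fin (F.rank i) → Γ}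
    {ε : ∀ i, Fin (G.rank i) → Γ} (hF : F.IsGradedBy 𝒜 𝒩 δ) (hG : G.IsGradedBy 𝒜 𝒩 ε) :
    ∃ α, IsLift LinearMap.id F G α ∧
      ∀ i j, ∀ x ∈ freePiece 𝒜 (δ i) j, α i x ∈ freePiece 𝒜 (ε i) j := by
  obtain ⟨α, hα, hαmem⟩ := exists_isLift_mem LinearMap.id F G
    (fun i a => freePiece 𝒜 (ε i) (δ i a))
    (fun a => by
      obtain ⟨y, hy⟩ := G.aug_surjective (F.aug (Pi.single a 1))
      exact ⟨freeComponent 𝒜 (ε 0) (δ 0 a) y, freeComponent_mem _ _ _,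
        (map_freeComponent_eq h𝒩 hG.aug_mem (hy ▸ hF.aug_mem a)).trans hy⟩)
    (fun i φ hφ a ⟨y, hy⟩ => by
      have hmem : φ (F.d i (Pi.single a 1)) ∈ freePiece 𝒜 (ε i) (δ (i + 1) a) := by
        simpa using map_mem_of_mem_freePiece (c := 0) (by simpa using hφ) (hF.d_mem i a)
      exact ⟨freeComponent 𝒜 (ε (i + 1)) (δ (i + 1) a) y, freeComponent_mem _ _ _,
        (map_freeComponent_eq (iSupIndep_freePiece _) (hG.d_mem i) (hy ▸ hmem)).trans hy⟩)
  exact ⟨α, hα, fun i j x hx => by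
    simpa using map_mem_of_mem_freePiece (c := 0) (by simpa using hαmem i) hx⟩

end FreeResolution

namespace GradedFreeResolution

variable {k : Type v} [Field k] {R : Type u} [CommRing R] [Algebra k R]
  {𝒜 : ℤ → Submodule k R} {M : Type u} [AddCommGroup M] [Module R M]
  {ℳ : ℤ → AddSubgroup M}

lemma isGradedBy (F : GradedFreeResolution 𝒜 ℳ) : F.toFreeResolution.IsGradedBy 𝒜 ℳ F.deg :=
  ⟨F.d_mem, F.aug_mem⟩

lemma mem_maxPart_iff (F : GradedFreeResolution 𝒜 ℳ) {i : ℕ} {x : F.X i} :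
    x ∈ F.maxPart i ↔ ∀ a, x a ∈ gradedMaximalIdeal 𝒜 :=
  mem_smul_top_pi_iff _

variable [GradedAlgebra 𝒜]

/-- The `k`-linear combinations of the basis vectors of degree `j` in `F i`; they represent the
degree `j` component of `k ⊗ F i`. -/
def combination (F : GradedFreeResolution 𝒜 ℳ) (i : ℕ) (j : ℤ) :
    ({a // F.deg i a = j} → k) →ₗ[k] F.piece i j where
  toFun c := ⟨fun a => if h : F.deg i a = j then algebraMap k R (c ⟨a, h⟩) else 0, fun a => by
    dsimp only
    split_ifs with h
    · rw [h, sub_self]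
      exact SetLike.algebraMap_mem_graded 𝒜 _
    · exact zero_mem _⟩
  map_add' c c' := by
    ext a
    by_cases h : F.deg i a = j <;> simp [h]
  map_smul' r c := by
    ext a
    by_cases h : F.deg i a = j <;> simp [h, Algebra.smul_def]

lemma combination_apply_of_eq (F : GradedFreeResolution 𝒜 ℳ) {i : ℕ} {j : ℤ}
    (c : {a // F.deg i a = j} → k) {a : Fin (F.rank i)} (h : F.deg i a = j) :
    (F.combination i j c : F.X i) a = algebraMap k R (c ⟨a, h⟩) :=
  dif_pos h

lemma combination_apply_of_ne (F : GradedFreeResolution 𝒜 ℳ) {i : ℕ} {j : ℤ}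
    (c : {a // F.deg i a = j} → k) {a : Fin (F.rank i)} (h : F.deg i a ≠ j) :
    (F.combination i j c : F.X i) a = 0 :=
  dif_neg h

lemma mkQ_combination_surjective (h𝒜 : IsConnectedGraded 𝒜) (F : GradedFreeResolution 𝒜 ℳ)
    (i : ℕ) (j : ℤ) : Function.Surjective
      (((F.maxPart i).submoduleOf (F.piece i j)).mkQ ∘ₗ F.combination i j) := by
  intro z
  obtain ⟨⟨x, hx⟩, rfl⟩ := Submodule.Quotient.mk_surjective _ z
  have hx₀ (a : {a // F.deg i a = j}) : x a ∈ 𝒜 0 := by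
    have := hx a
    rwa [a.2, sub_self] at this
  choose c hc using fun a => h𝒜.zero _ (hx₀ a)
  refine ⟨c, (Submodule.Quotient.eq _).2 ((mem_maxPart_iff F).2 fun a => ?_)⟩
  change (F.combination i j c : F.X i) a - x a ∈ _
  by_cases h : F.deg i a = j
  · rw [F.combination_apply_of_eq c h, hc, sub_self]
    exact zero_mem _
  · rw [F.combination_apply_of_ne c h, zero_sub, neg_mem_iff]
    exact h𝒜.mem_gradedMaximalIdeal (hx a) (sub_ne_zero.2 (Ne.symm h))

lemma eq_zero_of_combination_mem_maxPart (h𝒜 : IsConnectedGraded 𝒜)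
    (F : GradedFreeResolution 𝒜 ℳ) {i : ℕ} {j : ℤ} {c : {a // F.deg i a = j} → k}
    (hc : (F.combination i j c : F.X i) ∈ F.maxPart i) : c = 0 := by
  ext a
  have := (mem_maxPart_iff F).1 hc a
  rw [F.combination_apply_of_eq c a.2] at this
  exact h𝒜.eq_zero_of_algebraMap_mem this

lemma finite_red (h𝒜 : IsConnectedGraded 𝒜) (F : GradedFreeResolution 𝒜 ℳ) (i : ℕ) (j : ℤ) :
    Module.Finite k (F.red i j) :=
  Module.Finite.of_surjective _ (F.mkQ_combination_surjective h𝒜 i j)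

lemma finrank_tor_le_card (h𝒜 : IsConnectedGraded 𝒜) (F : GradedFreeResolution 𝒜 ℳ) (i : ℕ)
    (j : ℤ) : Module.finrank k (F.tor i j) ≤ Fintype.card {a // F.deg i a = j} := by
  have := F.finite_red h𝒜 i j
  calc Module.finrank k (F.tor i j) ≤ Module.finrank k (F.redZ j i) :=
        Submodule.finrank_quotient_le _
    _ ≤ Module.finrank k (F.red i j) := Submodule.finrank_le _
    _ ≤ Module.finrank k ({a // F.deg i a = j} → k) :=
        LinearMap.finrank_le_finrank_of_surjective (F.mkQ_combination_surjective h𝒜 i j)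
    _ = Fintype.card {a // F.deg i a = j} := Module.finrank_fintype_fun_eq_card k

lemma mk_mem_redZ {F G : GradedFreeResolution 𝒜 ℳ} (hF : F.IsMinimal (gradedMaximalIdeal 𝒜))
    {α : ∀ i, F.X i →ₗ[R] G.X i}
    (hα : FreeResolution.IsLift LinearMap.id F.toFreeResolution G.toFreeResolution α) (j : ℤ)
    (i : ℕ) (x : F.X i) (hx : α i x ∈ G.piece i j) :
    (Submodule.Quotient.mk ⟨α i x, hx⟩ : G.red i j) ∈ G.redZ j i := by
  cases i with
  | zero => trivial
  | succ i =>
    refine (Submodule.Quotient.mk_eq_zero _).2 ?_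
    change G.d i (α (i + 1) x) ∈ gradedMaximalIdeal 𝒜 • (⊤ : Submodule R (G.X i))
    rw [hα.d_apply]
    exact Submodule.smul_top_le_comap_smul_top _ (α i) (hF.d_mem i x)

lemma card_le_finrank_tor (h𝒜 : IsConnectedGraded 𝒜) [SetLike.GradedSMul 𝒜 ℳ]
    (hℳ : iSupIndep ℳ) {F : GradedFreeResolution 𝒜 ℳ} (hF : F.IsMinimal (gradedMaximalIdeal 𝒜))
    (G : GradedFreeResolution 𝒜 ℳ) (i : ℕ) (j : ℤ) :
    Fintype.card {a // F.deg i a = j} ≤ Module.finrank k (G.tor i j) := by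
  have := G.finite_red h𝒜 i j
  obtain ⟨α, hα, hαmem⟩ := F.isGradedBy.exists_isLift hℳ G.isGradedBy
  let f : ({a // F.deg i a = j} → k) →ₗ[k] G.tor i j :=
    Submodule.mkQ _ ∘ₗ LinearMap.codRestrict (G.redZ j i)
      (Submodule.mkQ _ ∘ₗ ((α i).restrictScalars k).restrict (hαmem i j) ∘ₗ F.combination i j)
      fun _ => mk_mem_redZ hF hα j i _ _
  have hf : Function.Injective f := by
    rw [injective_iff_map_eq_zero]
    intro c hc
    obtain ⟨z, hz⟩ := (Submodule.Quotient.mk_eq_zero _).1 hc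
    obtain ⟨⟨w, hw⟩, rfl⟩ := Submodule.Quotient.mk_surjective _ z
    have hsub : G.d i w - α i (F.combination i j c) ∈
        gradedMaximalIdeal 𝒜 • (⊤ : Submodule R (G.X i)) :=
      (Submodule.Quotient.eq ((G.maxPart i).submoduleOf (G.piece i j))).1 hz
    exact F.eq_zero_of_combination_mem_maxPart h𝒜
      (hα.mem_smul_top_of_sub_d_mem hF (by rwa [sub_mem_comm_iff] at hsub))
  calc Fintype.card {a // F.deg i a = j} = Module.finrank k ({a // F.deg i a = j} → k) :=
        (Module.finrank_fintype_fun_eq_card k).symm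
    _ ≤ Module.finrank k (G.tor i j) := LinearMap.finrank_le_finrank_of_injective hf

lemma gradedBetti_eq_card (h𝒜 : IsConnectedGraded 𝒜) [SetLike.GradedSMul 𝒜 ℳ]
    (hℳ : iSupIndep ℳ) {F : GradedFreeResolution 𝒜 ℳ} (hF : F.IsMinimal (gradedMaximalIdeal 𝒜))
    (i : ℕ) (j : ℤ) : gradedBetti 𝒜 ℳ i j = Fintype.card {a // F.deg i a = j} := by
  have : Nonempty (GradedFreeResolution 𝒜 ℳ) := ⟨F⟩
  exact le_antisymm ((ciInf_le' _ F).trans (F.finrank_tor_le_card h𝒜 i j))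
    (le_ciInf fun G => card_le_finrank_tor h𝒜 hℳ hF G i j)

lemma totalBetti_eq_rank (h𝒜 : IsConnectedGraded 𝒜) {F : GradedFreeResolution 𝒜 ℳ}
    (hF : F.IsMinimal (gradedMaximalIdeal 𝒜)) (s : ℕ) : totalBetti 𝒜 ℳ s = F.rank s := by
  have : Nonempty (GradedMinRes 𝒜 ℳ) := ⟨⟨F, hF⟩⟩
  rw [totalBetti, iInf_congr fun G : GradedMinRes 𝒜 ℳ =>
    G.2.rank_eq h𝒜.gradedMaximalIdeal_ne_top hF s, ciInf_const]

end GradedFreeResolution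

section Homogeneity

variable {Γ σ : Type*} [AddCommGroup Γ] {R : Type u} [CommRing R] [SetLike σ R]
  [AddSubgroupClass σ R] {𝒜 : Γ → σ} {M : Type u} [AddCommGroup M] [Module R M]
  {ℳ : Γ → AddSubgroup M}

instance gradedSMul_map_mkQ [SetLike.GradedMonoid 𝒜] (I : Ideal R) :
    SetLike.GradedSMul 𝒜 fun j =>
      (AddSubgroup.ofClass (𝒜 j)).map (Submodule.mkQ I).toAddMonoidHom where
  smul_mem _ _ r _ hr := by
    rintro ⟨s, hs, rfl⟩
    exact ⟨r * s, SetLike.mul_mem_graded hr hs, rfl⟩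

variable [DecidableEq Γ] [GradedRing 𝒜]

lemma iSupIndep_map_mkQ {I : Ideal R} (hI : I.IsHomogeneous 𝒜) :
    iSupIndep fun j => (AddSubgroup.ofClass (𝒜 j)).map (Submodule.mkQ I).toAddMonoidHom := by
  refine fun j => AddSubgroup.disjoint_def.2 ?_
  rintro _ ⟨r, hr, rfl⟩ hx
  have hle : ⨆ i, ⨆ (_ : i ≠ j), (AddSubgroup.ofClass (𝒜 i)).map
      (Submodule.mkQ I).toAddMonoidHom ≤
        (GradedRing.proj 𝒜 j).ker.map (Submodule.mkQ I).toAddMonoidHom :=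
    iSup₂_le fun i hi => AddSubgroup.map_mono fun s hs => DirectSum.decompose_of_mem_ne 𝒜 hs hi
  obtain ⟨s, hs, hsr⟩ := hle hx
  have hI' := hI j ((Submodule.Quotient.eq I).1 hsr.symm)
  rw [DirectSum.decompose_sub, DirectSum.sub_apply, AddSubgroupClass.coe_sub,
    DirectSum.decompose_of_mem_same 𝒜 hr, ← GradedRing.proj_apply, AddMonoidHom.mem_ker.1 hs,
    sub_zero] at hI'
  exact (Submodule.Quotient.mk_eq_zero I).2 hI'

variable {t : ℕ} {m : Fin t → M} {d : Fin t → Γ}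

lemma linearCombination_freeComponent_eq_zero [SetLike.GradedSMul 𝒜 ℳ] (hℳ : iSupIndep ℳ)
    (hm : ∀ l, m l ∈ ℳ (d l)) {b : Fin t → R} (hb : Fintype.linearCombination R m b = 0) (j : Γ) :
    Fintype.linearCombination R m (freeComponent 𝒜 d j b) = 0 := by
  rw [map_freeComponent_eq hℳ (by simpa using hm) (hb ▸ zero_mem (ℳ j)), hb]

lemma mem_colonIdeal_iff_exists {l : Fin t} {r : R} : r ∈ colonIdeal R m l ↔
    ∃ b : Fin t → R, Fintype.linearCombination R m b = 0 ∧ b l = r ∧ ∀ i, l < i → b i = 0 := by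
  have hsplit (b : Fin t → R) : Fintype.linearCombination R m b =
      b l • m l + ∑ i ∈ Finset.univ.erase l, b i • m i := by
    rw [Fintype.linearCombination_apply, Finset.add_sum_erase _ (fun i => b i • m i)
      (Finset.mem_univ l)]
  rw [mem_colonIdeal_iff]
  constructor
  · intro h
    obtain ⟨c, hcl, hc⟩ := (Finsupp.mem_span_image_iff_linearCombination R).1 h
    have hc₀ {i : Fin t} (hi : l ≤ i) : c i = 0 :=
      Finsupp.notMem_support_iff.1 fun h => hi.not_gt (hcl h)
    refine ⟨Pi.single l r - ⇑c, ?_, ?_, fun i hi => ?_⟩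
    · rw [map_sub, Fintype.linearCombination_apply_single, fintype_linearCombination_coe, hc,
        sub_self]
    · rw [Pi.sub_apply, Pi.single_eq_same, hc₀ le_rfl, sub_zero]
    · rw [Pi.sub_apply, Pi.single_eq_of_ne hi.ne', hc₀ hi.le, sub_zero]
  · rintro ⟨b, hb, rfl, hbl⟩
    rw [hsplit, add_eq_zero_iff_eq_neg] at hb
    rw [hb, neg_mem_iff]
    refine sum_mem fun i hi => ?_
    rcases (Finset.ne_of_mem_erase hi).lt_or_gt with hi | hi
    · exact Submodule.smul_mem _ _ (mem_initial_of_lt hi)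
    · rw [hbl i hi, zero_smul]
      exact zero_mem _

lemma colonIdeal_isHomogeneous [SetLike.GradedSMul 𝒜 ℳ] (hℳ : iSupIndep ℳ)
    (hm : ∀ l, m l ∈ ℳ (d l)) (l : Fin t) : (colonIdeal R m l).IsHomogeneous 𝒜 := by
  intro j r hr
  obtain ⟨b, hb, rfl, hbl⟩ := mem_colonIdeal_iff_exists.1 hr
  refine mem_colonIdeal_iff_exists.2 ⟨freeComponent 𝒜 d (j + d l) b,
    linearCombination_freeComponent_eq_zero hℳ hm hb _, ?_, fun i hi => ?_⟩
  · rw [freeComponent_apply, add_sub_cancel_right, GradedRing.proj_apply]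
  · rw [freeComponent_apply, hbl i hi, map_zero]

end Homogeneity

section Generators

variable {R : Type u} [CommRing R] {M : Type u} [AddCommGroup M] [Module R M] {t : ℕ}
  {m : Fin t → M}

lemma IsMinimalGenerators.not_isUnit (hm : IsMinimalGenerators (R := R) m) {b : Fin t → R}
    (hb : Fintype.linearCombination R m b = 0) (j : Fin t) : ¬IsUnit (b j) := by
  intro hj
  have hmem (l) (hl : l ≠ j) : m l ∈ Submodule.span R (m '' {j}ᶜ) :=
    Submodule.subset_span ⟨l, hl, rfl⟩
  have hmj : m j ∈ Submodule.span R (m '' {j}ᶜ) := by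
    rw [Fintype.linearCombination_apply, ← Finset.add_sum_erase _ _ (Finset.mem_univ j),
      add_eq_zero_iff_eq_neg] at hb
    rw [← Submodule.smul_mem_iff_of_isUnit _ hj, hb]
    exact neg_mem (sum_mem fun l hl => Submodule.smul_mem _ _ (hmem l (Finset.ne_of_mem_erase hl)))
  refine hm.2 j (top_le_iff.1 (hm.1.ge.trans (Submodule.span_le.2 ?_)))
  rintro _ ⟨l, rfl⟩
  by_cases hl : l = j
  · exact hl ▸ hmj
  · exact hmem l hl

lemma IsMinimalGenerators.mem_maximalIdeal [IsLocalRing R] (hm : IsMinimalGenerators (R := R) m)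
    {b : Fin t → R} (hb : Fintype.linearCombination R m b = 0) (j : Fin t) :
    b j ∈ IsLocalRing.maximalIdeal R :=
  (IsLocalRing.mem_maximalIdeal _).2 (hm.not_isUnit hb j)

lemma IsMinimalGenerators.mem_gradedMaximalIdeal {k : Type v} [Field k] [Algebra k R]
    {𝒜 : ℤ → Submodule k R} [GradedAlgebra 𝒜] {ℳ : ℤ → AddSubgroup M} [SetLike.GradedSMul 𝒜 ℳ]
    (hm : IsMinimalGenerators (R := R) m) (h𝒜 : IsConnectedGraded 𝒜) (hℳ : iSupIndep ℳ)
    {d : Fin t → ℤ} (hd : ∀ l, m l ∈ ℳ (d l)) {b : Fin t → R}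
    (hb : Fintype.linearCombination R m b = 0) (j : Fin t) : b j ∈ gradedMaximalIdeal 𝒜 := by
  by_contra hj
  refine hm.not_isUnit
    (linearCombination_freeComponent_eq_zero (𝒜 := 𝒜) hℳ hd hb (d j)) j ?_
  rw [freeComponent_apply, sub_self]
  exact h𝒜.isUnit_proj_zero hj

end Generators

/-- Transport of a resolution along an isomorphism. -/
def FreeResolution.congr {R : Type u} [CommRing R] {M N : Type u} [AddCommGroup M] [Module R M]
    [AddCommGroup N] [Module R N] (F : FreeResolution R N) (e : N ≃ₗ[R] M) :
    FreeResolution R M where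
  rank := F.rank
  d := F.d
  aug := e.toLinearMap ∘ₗ F.aug
  aug_surjective := e.surjective.comp F.aug_surjective
  exact_zero x := e.map_eq_zero_iff.trans (F.exact_zero x)
  exact_succ := F.exact_succ

section Local

/-- The grading of an abelian group by the trivial group, in which every element has degree `0`.
It makes the local case a special case of the graded one. -/
abbrev trivialGrading (A : Type*) [AddCommGroup A] : PUnit.{1} → AddSubgroup A := fun _ => ⊤

instance gradedRing_trivialGrading (R : Type*) [CommRing R] : GradedRing (trivialGrading R) where
  one_mem := AddSubgroup.mem_top _
  mul_mem _ _ _ _ _ _ := AddSubgroup.mem_top _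
  toDecomposition := .ofAddHom _
    ((DirectSum.of (fun i => trivialGrading R i) PUnit.unit).comp
      AddSubgroup.topEquiv.symm.toAddMonoidHom)
    (AddMonoidHom.ext fun _ => DirectSum.coeAddMonoidHom_of _ _ _)
    (DirectSum.addHom_ext fun _ _ => congrArg
      (fun r => DirectSum.of (fun i => trivialGrading R i) PUnit.unit ⟨r, AddSubgroup.mem_top r⟩)
      (DirectSum.coeAddMonoidHom_of _ _ _))

instance gradedSMul_trivialGrading (R M : Type*) [CommRing R] [AddCommGroup M] [Module R M] :
    SetLike.GradedSMul (trivialGrading R) (trivialGrading M) where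
  smul_mem _ _ _ _ _ _ := AddSubgroup.mem_top _

lemma isHomogeneous_trivialGrading {R : Type*} [CommRing R] (I : Ideal R) :
    I.IsHomogeneous (trivialGrading R) := by
  intro _ r hr
  rwa [DirectSum.decompose_of_mem_same (trivialGrading R) (AddSubgroup.mem_top r)]

variable {R : Type u} [CommRing R] [IsLocalRing R] {M : Type u} [AddCommGroup M] [Module R M]

lemma isKoszul_iff : IsKoszul R M ↔ ∃ F : FreeResolution R M,
    F.IsMinimal (IsLocalRing.maximalIdeal R) ∧ F.IsLinear (IsLocalRing.maximalIdeal R) := by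
  rw [IsKoszul, linearityDefect]
  constructor
  · intro h
    have : Nonempty (MinRes R M) := by
      by_contra! hne
      simp at h
    obtain ⟨F, hF⟩ := ciInf_mem fun F : MinRes R M => FreeResolution.linDefect F.2
    exact ⟨F.1, F.2, (FreeResolution.linDefect_eq_zero_iff F.2).1 (hF.trans h)⟩
  · rintro ⟨F, hF, hlin⟩
    exact nonpos_iff_eq_zero.1 ((iInf_le _ (⟨F, hF⟩ : MinRes R M)).trans
      ((FreeResolution.linDefect_eq_zero_iff hF).2 hlin).le)

lemma betti_eq_rank {F : FreeResolution R M} (hF : F.IsMinimal (IsLocalRing.maximalIdeal R))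
    (s : ℕ) : betti R M s = F.rank s := by
  have : Nonempty (MinRes R M) := ⟨⟨F, hF⟩⟩
  rw [betti, iInf_congr fun G : MinRes R M =>
    G.2.rank_eq Ideal.IsPrime.ne_top' hF s, ciInf_const]

variable {t : ℕ} {m : Fin t → M} {G : ∀ l, FreeResolution R (R ⧸ colonIdeal R m l)}

lemma IsMinimalGenerators.exists_linear_resolution_initial
    (hm : IsMinimalGenerators (R := R) m)
    (hmin : ∀ l, (G l).IsMinimal (IsLocalRing.maximalIdeal R))
    (hlin : ∀ l, (G l).IsLinear (IsLocalRing.maximalIdeal R)) (i : ℕ) (hi : i ≤ t) :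
    ∃ F : FreeResolution R (initial R m i), F.IsMinimal (IsLocalRing.maximalIdeal R) ∧
      F.IsLinear (IsLocalRing.maximalIdeal R) ∧
      ∀ s, F.rank s = ∑ l : Fin i, (G (l.castLE hi)).rank s := by
  obtain ⟨F, -, hFmin, hFlin, -, hrank, -⟩ := exists_isGradedBy_resolution_initial
    (isHomogeneous_trivialGrading _) (ℳ := trivialGrading M) (iSupIndep_subsingleton _)
    (d := 0) (fun _ => AddSubgroup.mem_top _) (fun _ => hm.mem_maximalIdeal)
    (δ := fun _ _ _ => 0) hmin hlin
    (fun l => ⟨fun _ _ _ => AddSubgroup.mem_top _, fun a =>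
      (Submodule.mkQ_surjective _ ((G l).aug (Pi.single a 1))).imp fun r hr =>
        ⟨AddSubgroup.mem_top r, hr⟩⟩) i hi
  exact ⟨F, hFmin, hFlin, hrank⟩

lemma IsMinimalGenerators.exists_linear_resolution (hm : IsMinimalGenerators (R := R) m)
    (hmin : ∀ l, (G l).IsMinimal (IsLocalRing.maximalIdeal R))
    (hlin : ∀ l, (G l).IsLinear (IsLocalRing.maximalIdeal R)) :
    ∃ F : FreeResolution R M, F.IsMinimal (IsLocalRing.maximalIdeal R) ∧
      F.IsLinear (IsLocalRing.maximalIdeal R) ∧ ∀ s, F.rank s = ∑ l, (G l).rank s := by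
  obtain ⟨F, hFmin, hFlin, hrank⟩ := hm.exists_linear_resolution_initial hmin hlin t le_rfl
  exact ⟨F.congr (LinearEquiv.ofTop _ (initial_self.trans hm.1)), hFmin, hFlin, hrank⟩

end Local

section Graded

variable {k : Type v} [Field k] {R : Type u} [CommRing R] [Algebra k R]
  {𝒜 : ℤ → Submodule k R} {M : Type u} [AddCommGroup M] [Module R M] {ℳ : ℤ → AddSubgroup M}

/-- The graded resolution given by a resolution whose maps preserve the degrees for the degrees
`deg` of the basis vectors. -/
def GradedFreeResolution.ofIsGradedBy (F : FreeResolution R M) {deg : ∀ i, Fin (F.rank i) → ℤ}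
    (h : F.IsGradedBy 𝒜 ℳ deg) : GradedFreeResolution 𝒜 ℳ :=
  { F with deg := deg, d_mem := h.d_mem, aug_mem := h.aug_mem }

lemma isGradedKoszul_iff : IsGradedKoszul 𝒜 ℳ ↔ ∃ F : GradedFreeResolution 𝒜 ℳ,
    F.IsMinimal (gradedMaximalIdeal 𝒜) ∧ F.IsLinear (gradedMaximalIdeal 𝒜) := by
  rw [IsGradedKoszul, gradedLinearityDefect]
  constructor
  · intro h
    have : Nonempty (GradedMinRes 𝒜 ℳ) := by
      by_contra! hne
      simp at h
    obtain ⟨F, hF⟩ := ciInf_mem fun F : GradedMinRes 𝒜 ℳ => FreeResolution.linDefect F.2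
    exact ⟨F.1, F.2, (FreeResolution.linDefect_eq_zero_iff F.2).1 (hF.trans h)⟩
  · rintro ⟨F, hF, hlin⟩
    exact nonpos_iff_eq_zero.1 ((iInf_le _ (⟨F, hF⟩ : GradedMinRes 𝒜 ℳ)).trans
      ((FreeResolution.linDefect_eq_zero_iff hF).2 hlin).le)

variable [GradedAlgebra 𝒜]

lemma gradedBetti_quotGrading_eq_card (h𝒜 : IsConnectedGraded 𝒜) {I : Ideal R}
    (hI : I.IsHomogeneous 𝒜) {G : GradedFreeResolution 𝒜 (quotGrading 𝒜 I)}
    (hG : G.IsMinimal (gradedMaximalIdeal 𝒜)) (i : ℕ) (j : ℤ) :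
    gradedBetti 𝒜 (quotGrading 𝒜 I) i j = Fintype.card {a // G.deg i a = j} := by
  have : SetLike.GradedSMul 𝒜 (quotGrading 𝒜 I) := gradedSMul_map_mkQ I
  exact G.gradedBetti_eq_card h𝒜 (iSupIndep_map_mkQ hI) hG i j

lemma regularity_le_iff {c : EReal} : regularity 𝒜 ℳ ≤ c ↔
    ∀ (i : ℕ) (j : ℤ), gradedBetti 𝒜 ℳ i j ≠ 0 → (((j - i : ℤ) : ℝ) : EReal) ≤ c := by
  simp only [regularity, iSup_le_iff]

lemma regularity_add_le_iff {d : ℤ} {c : EReal} :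
    regularity 𝒜 ℳ + ((d : ℝ) : EReal) ≤ c ↔
      ∀ (i : ℕ) (j : ℤ), gradedBetti 𝒜 ℳ i (j - d) ≠ 0 → (((j - i : ℤ) : ℝ) : EReal) ≤ c := by
  rw [← EReal.le_sub_iff_add_le (.inl (EReal.coe_ne_bot _)) (.inl (EReal.coe_ne_top _)),
    regularity_le_iff]
  refine forall_congr' fun i => (Equiv.subRight d).forall_congr_right.symm.trans
    (forall_congr' fun j => imp_congr_right fun _ => ?_)
  rw [EReal.le_sub_iff_add_le (.inl (EReal.coe_ne_bot _)) (.inl (EReal.coe_ne_top _)),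
    ← EReal.coe_add, ← Int.cast_add, Equiv.subRight_apply, sub_right_comm, sub_add_cancel]

lemma regularity_eq_iSup {ι : Type*} [Fintype ι] {N : ι → Type u} [∀ l, AddCommGroup (N l)]
    [∀ l, Module R (N l)] {𝒩 : ∀ l, ℤ → AddSubgroup (N l)} {d : ι → ℤ}
    (h : ∀ s j, gradedBetti 𝒜 ℳ s j = ∑ l, gradedBetti 𝒜 (𝒩 l) s (j - d l)) :
    regularity 𝒜 ℳ = ⨆ l, (regularity 𝒜 (𝒩 l) + (((d l : ℤ) : ℝ) : EReal)) := by
  refine eq_of_forall_ge_iff fun c => ?_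
  simp only [iSup_le_iff, regularity_add_le_iff, regularity_le_iff, h, ne_eq,
    Finset.sum_eq_zero_iff, Finset.mem_univ, true_imp_iff, not_forall, forall_exists_index]
  exact ⟨fun H l i j => H i j l, fun H i j l => H l i j⟩

variable [DirectSum.Decomposition ℳ] [SetLike.GradedSMul 𝒜 ℳ] {t : ℕ} {m : Fin t → M}
  {d : Fin t → ℤ}
  {G : ∀ l, GradedFreeResolution 𝒜 (quotGrading 𝒜 (colonIdeal R m l))}

lemma IsMinimalGenerators.exists_linear_gradedResolution_initial
    (hm : IsMinimalGenerators (R := R) m) (h𝒜 : IsConnectedGraded 𝒜) (hd : ∀ l, m l ∈ ℳ (d l))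
    (hmin : ∀ l, (G l).IsMinimal (gradedMaximalIdeal 𝒜))
    (hlin : ∀ l, (G l).IsLinear (gradedMaximalIdeal 𝒜)) (i : ℕ) (hi : i ≤ t) :
    ∃ F : GradedFreeResolution 𝒜 (subGrading ℳ (initial R m i)),
      F.IsMinimal (gradedMaximalIdeal 𝒜) ∧ F.IsLinear (gradedMaximalIdeal 𝒜) ∧
      (∀ s, F.rank s = ∑ l : Fin i, (G (l.castLE hi)).rank s) ∧
      ∀ s j, Fintype.card {a // F.deg s a = j} = ∑ l : Fin i,
        Fintype.card {a // (G (l.castLE hi)).deg s a = j - d (l.castLE hi)} := by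
  have hℳ : iSupIndep ℳ := (DirectSum.Decomposition.isInternal ℳ).addSubgroup_iSupIndep
  obtain ⟨F, deg, hFmin, hFlin, hFgr, hrank, hcount⟩ := exists_isGradedBy_resolution_initial
    gradedMaximalIdeal_isHomogeneous hℳ hd (fun _ => hm.mem_gradedMaximalIdeal h𝒜 hℳ hd) hmin hlin
    (fun l => (G l).isGradedBy) i hi
  exact ⟨.ofIsGradedBy F hFgr, hFmin, hFlin, hrank, hcount⟩

lemma IsMinimalGenerators.exists_linear_gradedResolution
    (hm : IsMinimalGenerators (R := R) m) (h𝒜 : IsConnectedGraded 𝒜) (hd : ∀ l, m l ∈ ℳ (d l))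
    (hmin : ∀ l, (G l).IsMinimal (gradedMaximalIdeal 𝒜))
    (hlin : ∀ l, (G l).IsLinear (gradedMaximalIdeal 𝒜)) :
    ∃ F : GradedFreeResolution 𝒜 ℳ,
      F.IsMinimal (gradedMaximalIdeal 𝒜) ∧ F.IsLinear (gradedMaximalIdeal 𝒜) ∧
      (∀ s, F.rank s = ∑ l, (G l).rank s) ∧
      ∀ s j, Fintype.card {a // F.deg s a = j} =
        ∑ l, Fintype.card {a // (G l).deg s a = j - d l} := by
  obtain ⟨F, hFmin, hFlin, hrank, hcount⟩ :=
    hm.exists_linear_gradedResolution_initial h𝒜 hd hmin hlin t le_rfl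
  exact ⟨.ofIsGradedBy (F.congr (LinearEquiv.ofTop _ (initial_self.trans hm.1)))
    ⟨F.d_mem, F.aug_mem⟩, hFmin, hFlin, hrank, hcount⟩

end Graded

end LinQuot

end

open LinQuot in
theorem proposition5p11_general :
    (∀ (R : Type u) [CommRing R] [IsLocalRing R] (M : Type u) [AddCommGroup M] [Module R M]
        (t : ℕ) (m : Fin t → M),
      IsMinimalGenerators (R := R) m → (∀ i, IsKoszul R (R ⧸ colonIdeal R m i)) →
        (∀ i : ℕ, i ≤ t → IsKoszul R (initial R m i)) ∧
        IsKoszul R M ∧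
        (∀ s : ℕ, betti R M s = ∑ i, betti R (R ⧸ colonIdeal R m i) s) ∧
        projDim R M = ⨆ i, projDim R (R ⧸ colonIdeal R m i)) ∧
    (∀ (k : Type v) [Field k] (R : Type u) [CommRing R] [Algebra k R]
        (𝒜 : ℤ → Submodule k R) [GradedAlgebra 𝒜], IsConnectedGraded 𝒜 →
      ∀ (M : Type u) [AddCommGroup M] [Module R M]
        (ℳ : ℤ → AddSubgroup M) [DirectSum.Decomposition ℳ] [SetLike.GradedSMul 𝒜 ℳ]
        (t : ℕ) (m : Fin t → M) (d : Fin t → ℤ),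
      (∀ i, m i ∈ ℳ (d i)) → IsMinimalGenerators (R := R) m →
      (∀ i, IsGradedKoszul 𝒜 (quotGrading 𝒜 (colonIdeal R m i))) →
        (∀ i : ℕ, i ≤ t → IsGradedKoszul 𝒜 (subGrading ℳ (initial R m i))) ∧
        IsGradedKoszul 𝒜 ℳ ∧
        (∀ s : ℕ, totalBetti 𝒜 ℳ s =
          ∑ i, totalBetti 𝒜 (quotGrading 𝒜 (colonIdeal R m i)) s) ∧
        projDim R M = (⨆ i, projDim R (R ⧸ colonIdeal R m i)) ∧
        (∀ (s : ℕ) (j : ℤ), gradedBetti 𝒜 ℳ s j =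
          ∑ i, gradedBetti 𝒜 (quotGrading 𝒜 (colonIdeal R m i)) s (j - d i)) ∧
        regularity 𝒜 ℳ = ⨆ i, (regularity 𝒜 (quotGrading 𝒜 (colonIdeal R m i)) +
          (((d i : ℤ) : ℝ) : EReal))) := by
  constructor
  · intro R _ _ M _ _ t m hm hK
    choose G hmin hlin using fun l => isKoszul_iff.1 (hK l)
    obtain ⟨F, hFmin, hFlin, hrank⟩ := hm.exists_linear_resolution hmin hlin
    refine ⟨fun i hi => ?_, isKoszul_iff.2 ⟨F, hFmin, hFlin⟩, fun s => ?_,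
      FreeResolution.projDim_eq_iSup_projDim Ideal.IsPrime.ne_top' hFmin hmin hrank⟩
    · obtain ⟨Fi, hFi, hFi', -⟩ := hm.exists_linear_resolution_initial hmin hlin i hi
      exact isKoszul_iff.2 ⟨Fi, hFi, hFi'⟩
    · simp only [betti_eq_rank hFmin, betti_eq_rank (hmin _), hrank]
  · intro k _ R _ _ 𝒜 _ h𝒜 M _ _ ℳ _ _ t m d hd hm hK
    choose G hmin hlin using fun l => isGradedKoszul_iff.1 (hK l)
    obtain ⟨F, hFmin, hFlin, hrank, hcount⟩ :=
      hm.exists_linear_gradedResolution h𝒜 hd hmin hlin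
    have hℳ : iSupIndep ℳ := (DirectSum.Decomposition.isInternal ℳ).addSubgroup_iSupIndep
    have hbetti (s : ℕ) (j : ℤ) : gradedBetti 𝒜 ℳ s j =
        ∑ i, gradedBetti 𝒜 (quotGrading 𝒜 (colonIdeal R m i)) s (j - d i) := by
      rw [F.gradedBetti_eq_card h𝒜 hℳ hFmin, hcount]
      exact Finset.sum_congr rfl fun l _ => (gradedBetti_quotGrading_eq_card h𝒜
        (colonIdeal_isHomogeneous hℳ hd l) (hmin l) s _).symm
    refine ⟨fun i hi => ?_, isGradedKoszul_iff.2 ⟨F, hFmin, hFlin⟩, fun s => ?_,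
      FreeResolution.projDim_eq_iSup_projDim h𝒜.gradedMaximalIdeal_ne_top hFmin hmin hrank, hbetti,
      regularity_eq_iSup hbetti⟩
    · obtain ⟨Fi, hFi, hFi', -⟩ :=
        hm.exists_linear_gradedResolution_initial h𝒜 hd hmin hlin i hi
      exact isGradedKoszul_iff.2 ⟨Fi, hFi, hFi'⟩
    · simp only [F.totalBetti_eq_rank h𝒜 hFmin, (G _).totalBetti_eq_rank h𝒜 (hmin _), hrank]

theorem proposition5p11 :
    -- the local case
    (∀ (R : Type u) [CommRing R] [IsLocalRing R] [IsNoetherianRing R]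
        (M : Type u) [AddCommGroup M] [Module R M] [Nontrivial M]
        (t : ℕ) (m : Fin t → M),
      LinQuot.IsMinimalGenerators (R := R) m →
      (∀ i, LinQuot.IsKoszul R (R ⧸ LinQuot.colonIdeal R m i)) →
        (∀ i : ℕ, 1 ≤ i → i ≤ t → LinQuot.IsKoszul R (LinQuot.initial R m i)) ∧
        LinQuot.IsKoszul R M ∧
        (∀ s : ℕ, LinQuot.betti R M s =
          ∑ i, LinQuot.betti R (R ⧸ LinQuot.colonIdeal R m i) s) ∧
        LinQuot.projDim R M = ⨆ i, LinQuot.projDim R (R ⧸ LinQuot.colonIdeal R m i)) ∧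
    -- the graded case
    (∀ (k : Type v) [Field k] (R : Type u) [CommRing R] [Algebra k R]
        (𝒜 : ℤ → Submodule k R) [GradedAlgebra 𝒜],
      LinQuot.IsStandardGraded 𝒜 →
      ∀ (M : Type u) [AddCommGroup M] [Module R M] [Nontrivial M]
        (ℳ : ℤ → AddSubgroup M) [DirectSum.Decomposition ℳ] [SetLike.GradedSMul 𝒜 ℳ]
        (t : ℕ) (m : Fin t → M) (d : Fin t → ℤ),
      (∀ i, m i ∈ ℳ (d i)) →
      LinQuot.IsMinimalGenerators (R := R) m →
      (∀ i, LinQuot.IsGradedKoszul 𝒜 (LinQuot.quotGrading 𝒜 (LinQuot.colonIdeal R m i))) →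
        (∀ i : ℕ, 1 ≤ i → i ≤ t →
          LinQuot.IsGradedKoszul 𝒜 (LinQuot.subGrading ℳ (LinQuot.initial R m i))) ∧
        LinQuot.IsGradedKoszul 𝒜 ℳ ∧
        (∀ s : ℕ, LinQuot.totalBetti 𝒜 ℳ s =
          ∑ i, LinQuot.totalBetti 𝒜 (LinQuot.quotGrading 𝒜 (LinQuot.colonIdeal R m i)) s) ∧
        LinQuot.projDim R M = (⨆ i, LinQuot.projDim R (R ⧸ LinQuot.colonIdeal R m i)) ∧
        (∀ (s : ℕ) (j : ℤ), LinQuot.gradedBetti 𝒜 ℳ s j =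
          ∑ i, LinQuot.gradedBetti 𝒜 (LinQuot.quotGrading 𝒜 (LinQuot.colonIdeal R m i)) s
            (j - d i)) ∧
        LinQuot.regularity 𝒜 ℳ =
          ⨆ i, (LinQuot.regularity 𝒜 (LinQuot.quotGrading 𝒜 (LinQuot.colonIdeal R m i)) +
            (((d i : ℤ) : ℝ) : EReal))) := by
  obtain ⟨hlocal, hgraded⟩ := proposition5p11_general
  exact ⟨fun R _ _ _ M _ _ _ t m hm hK => (hlocal R M t m hm hK).imp_left fun h i _ => h i,
    fun k _ R _ _ 𝒜 _ h𝒜 M _ _ _ ℳ _ _ t m d hd hm hK =>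
      (hgraded k R 𝒜 h𝒜.isConnectedGraded M ℳ t m d hd hm hK).imp_left fun h i _ => h i⟩
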